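/- Work in the complex projective plane $\mathbb{P}^2=\operatorname{Proj}\mathbb{C}[x,y,z]$. For integers $k,j\ge 0$ let the complete tic-tac-toe arrangement $\overline{\mathcal T}_k^{\,j}$ of type $(k,j)$ be the line arrangement consisting of the vertical lines $x=iz$ and the horizontal lines $y=iz$ for $i=-k,\dots,k$, the diagonals $x-y+iz=0$ and the anti-diagonals $x+y+iz=0$ for $i=-j,\dots,j$, and the line at infinity $z=0$. For a line arrangement $\mathcal A$ of $d$ lines, let $f_{\mathcal A}$ be the product of linear forms defining its lines, and let the derivation bundle $\mathcal D_{\mathcal A}$ be the kernel of the gradient map $(\partial_x f_{\mathcal A},\partial_y f_{\mathcal A},\partial_z f_{\mathcal A}):\mathcal O_{\mathbb P^2}^3\to\mathcal O_{\mathbb P^2}(d-1)$; the arrangement is called free with splitting type $(a,b)$ if $\mathcal D_{\mathcal A}\cong\mathcal O_{\mathbb P^2}(-a)\oplus\mathcal O_{\mathbb P^2}(-b)$. Let $k,j$ be positive integers with $k\ge j$. Then the complete tic-tac-toe arrangement $\overline{\mathcal T}_k^{\,j}$ is free with splitting type $(2k+1+2j,\;2k+3+2j)$. -/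

import Mathlib

open AlgebraicGeometry CategoryTheory CategoryTheory.Limits TopologicalSpace Opposite

section TwistingSheaf

universe u

variable {A σ : Type u} [CommRing A] [SetLike σ A] [AddSubgroupClass σ A] (𝒜 : ℕ → σ)
  [GradedRing 𝒜]

/-- The localization `A_𝔭` (all fractions, of every degree) at the homogeneous prime ideal of a
point of `Proj`. -/
abbrev ConeStalk (x : ProjectiveSpectrum.top 𝒜) : Type u :=
  Localization (Ideal.primeCompl (hp := x.isPrime) (HomogeneousIdeal.toIdeal x.asHomogeneousIdeal))

variable {𝒜} in
/-- `s` is given on all of `U` by one fraction `a / b` of homogeneous elements with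
`deg a - deg b = n`. -/
def IsTwistedFraction (n : ℤ) {U : Opens (ProjectiveSpectrum.top 𝒜)}
    (s : ∀ x : U, ConeStalk 𝒜 x.1) : Prop :=
  ∃ (i j : ℕ) (a b : A), a ∈ 𝒜 i ∧ b ∈ 𝒜 j ∧ (i : ℤ) = j + n ∧
    ∀ x : U, ∃ hb, s x = Localization.mk a ⟨b, hb⟩

/-- Being a fraction of degree `n`, as a condition that is stable under restriction. -/
def isTwistedFractionPrelocal (n : ℤ) : TopCat.PrelocalPredicate (ConeStalk 𝒜) where
  pred s := IsTwistedFraction n s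
  res := by
    rintro V U f s ⟨i, j, a, b, ha, hb, hij, h⟩
    exact ⟨i, j, a, b, ha, hb, hij, fun x => h (f x)⟩

/-- Being locally a fraction of degree `n`. -/
def isLocallyTwistedFraction (n : ℤ) : TopCat.LocalPredicate (ConeStalk 𝒜) :=
  (isTwistedFractionPrelocal 𝒜 n).sheafify

lemma exists_homogeneous_notMem (x : ProjectiveSpectrum 𝒜) :
    ∃ m : ℕ, 0 < m ∧ ∃ c ∈ 𝒜 m, c ∉ x.asHomogeneousIdeal := by
  by_contra! h
  exact x.not_irrelevant_le ((HomogeneousIdeal.irrelevant_le 𝒜).mpr fun i hi c hc => h i hi c hc)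

/-- The sections of `𝒪(n)` over `U`: the functions `x ↦ s x ∈ A_𝔭ₓ` on `U` that are locally
fractions of homogeneous elements, of degree `n`. -/
def twistSections (n : ℤ) (U : Opens (ProjectiveSpectrum.top 𝒜)) :
    AddSubgroup (∀ x : U, ConeStalk 𝒜 x.1) where
  carrier := {s | (isLocallyTwistedFraction 𝒜 n).pred s}
  zero_mem' x := by
    obtain ⟨m, hm, c, hc, hcx⟩ := exists_homogeneous_notMem 𝒜 x.1
    refine ⟨U ⊓ ProjectiveSpectrum.basicOpen 𝒜 c, ⟨x.2, hcx⟩, Opens.infLELeft _ _,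
      (((-n).toNat * m : ℕ) + n).toNat, (-n).toNat * m, 0, c ^ (-n).toNat, zero_mem _,
      by simpa using SetLike.pow_mem_graded (-n).toNat hc, ?_, fun y => ?_⟩
    · have h1 : (-n).toNat ≤ (-n).toNat * m := Nat.le_mul_of_pos_right _ hm
      generalize (-n).toNat * m = q at h1
      omega
    · exact ⟨Submonoid.pow_mem _ y.2.2 _, (Localization.mk_zero _).symm⟩
  add_mem' {s t} hs ht x := by
    obtain ⟨V, hV, iV, i, j, a, b, ha, hb, hij, h⟩ := hs x
    obtain ⟨W, hW, iW, i', j', a', b', ha', hb', hij', h'⟩ := ht x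
    refine ⟨V ⊓ W, ⟨hV, hW⟩, Opens.infLELeft _ _ ≫ iV, j + i', j + j', b * a' + b' * a, b * b',
      ?_, SetLike.mul_mem_graded hb hb', by push_cast; omega, fun y => ?_⟩
    · refine add_mem (SetLike.mul_mem_graded hb ha') ?_
      have : j + i' = j' + i := by omega
      rw [this]; exact SetLike.mul_mem_graded hb' ha
    · obtain ⟨h1, h2⟩ := h ⟨y.1, y.2.1⟩
      obtain ⟨h3, h4⟩ := h' ⟨y.1, y.2.2⟩
      refine ⟨mul_mem h1 h3, ?_⟩
      exact (congr($h2 + $h4)).trans (by rw [Localization.add_mk]; rfl)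
  neg_mem' {s} hs x := by
    obtain ⟨V, hV, iV, i, j, a, b, ha, hb, hij, h⟩ := hs x
    refine ⟨V, hV, iV, i, j, -a, b, neg_mem ha, hb, hij, fun y => ?_⟩
    obtain ⟨h1, h2⟩ := h y
    exact ⟨h1, (congr(-$h2)).trans (Localization.neg_mk _ _)⟩

/-- Regular functions on `U` (pointwise elements of the degree zero part of `A_𝔭`) act on the
sections of `𝒪(n)` by pointwise multiplication. -/
noncomputable instance twistSectionsModule (U : Opens (ProjectiveSpectrum.top 𝒜)) (n : ℤ) :
    Module ((ProjectiveSpectrum.Proj.structureSheaf 𝒜).1.obj (op U)) (twistSections 𝒜 n U) where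
  smul r s := ⟨fun x => HomogeneousLocalization.val (r.1 x) * s.1 x, fun x => by
    obtain ⟨V, hV, iV, i, ⟨a, ha⟩, ⟨b, hb⟩, h1, h2⟩ := r.2 x
    obtain ⟨W, hW, iW, i', j', a', b', ha', hb', hij', h'⟩ := s.2 x
    refine ⟨V ⊓ W, ⟨hV, hW⟩, Opens.infLELeft _ _ ≫ iV, i + i', i + j', a * a', b * b',
      SetLike.mul_mem_graded ha ha', SetLike.mul_mem_graded hb hb', by push_cast; omega,
      fun y => ?_⟩
    have h3 := h1 ⟨y.1, y.2.1⟩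
    have h4 := congr(HomogeneousLocalization.val $(h2 ⟨y.1, y.2.1⟩))
    obtain ⟨h5, h6⟩ := h' ⟨y.1, y.2.2⟩
    refine ⟨mul_mem h3 h5, ?_⟩
    refine (congr($h4 * $h6)).trans ?_
    rw [HomogeneousLocalization.val_mk, Localization.mk_mul]; rfl⟩
  one_smul s := Subtype.ext (funext fun x => by
    change HomogeneousLocalization.val (1 : HomogeneousLocalization _ _) * s.1 x = s.1 x
    rw [HomogeneousLocalization.val_one, one_mul])
  mul_smul r r' s := Subtype.ext (funext fun x => by
    change HomogeneousLocalization.val (r.1 x * r'.1 x) * s.1 x = _ * (_ * s.1 x)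
    rw [HomogeneousLocalization.val_mul, mul_assoc])
  smul_zero r := Subtype.ext (funext fun x => mul_zero _)
  smul_add r s t := Subtype.ext (funext fun x => mul_add _ _ _)
  add_smul r r' s := Subtype.ext (funext fun x => by
    change HomogeneousLocalization.val (r.1 x + r'.1 x) * s.1 x = _ * s.1 x + _ * s.1 x
    rw [HomogeneousLocalization.val_add, add_mul])
  zero_smul s := Subtype.ext (funext fun x => by
    change HomogeneousLocalization.val (0 : HomogeneousLocalization _ _) * s.1 x = 0
    rw [HomogeneousLocalization.val_zero, zero_mul])

/-- The presheaf of abelian groups `U ↦ 𝒪(n)(U)`. -/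
noncomputable def twistPresheafAb (n : ℤ) : TopCat.Presheaf Ab (ProjectiveSpectrum.top 𝒜) where
  obj U := .of (twistSections 𝒜 n U.unop)
  map {U V} i := AddCommGrpCat.ofHom
    { toFun := (TopCat.subsheafToTypes (isLocallyTwistedFraction 𝒜 n)).1.map i
      map_zero' := rfl
      map_add' := fun _ _ => rfl }

/-- Serre's twisting sheaf `𝒪(n)` on `Proj 𝒜`, as a sheaf of modules. In particular `𝒪(0)` is
the structure sheaf. -/
noncomputable def twistingSheaf (n : ℤ) : (Proj 𝒜).Modules where
  val :=
    letI (U : (Opens (Proj 𝒜))ᵒᵖ) :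
        Module ((Proj 𝒜).ringCatSheaf.obj.obj U) ((twistPresheafAb 𝒜 n).obj U) :=
      twistSectionsModule 𝒜 U.unop n
    PresheafOfModules.ofPresheaf (R := (Proj 𝒜).ringCatSheaf.obj) (twistPresheafAb 𝒜 n)
      fun _ _ _ _ _ => rfl
  isSheaf := (TopCat.Presheaf.isSheaf_iff_isSheaf_comp (forget AddCommGrpCat) _).2
    (TopCat.subsheafToTypes (isLocallyTwistedFraction 𝒜 n)).2

/-- Multiplication by a homogeneous element `g` of degree `e`, as a morphism
`𝒪(n) ⟶ 𝒪(n + e)`. -/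
noncomputable def twistMul {e : ℕ} (g : A) (hg : g ∈ 𝒜 e) (n m : ℤ) (h : n + e = m) :
    twistingSheaf 𝒜 n ⟶ twistingSheaf 𝒜 m where
  val := PresheafOfModules.homMk
    { app U := AddCommGrpCat.ofHom
        { toFun s := (⟨fun x => algebraMap A (ConeStalk 𝒜 x.1) g * s.1 x, fun x => by
              obtain ⟨V, hV, iV, i, j, a, b, ha, hb, hij, hs⟩ := s.2 x
              refine ⟨V, hV, iV, e + i, j, g * a, b, SetLike.mul_mem_graded hg ha, hb,
                by push_cast; omega, fun y => ?_⟩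
              obtain ⟨h1, h2⟩ := hs y
              refine ⟨h1, (congr(algebraMap A (ConeStalk 𝒜 y.1) g * $h2)).trans ?_⟩
              rw [← Localization.mk_one_eq_algebraMap, Localization.mk_mul, one_mul]⟩ :
            twistSections 𝒜 m U.unop)
          map_zero' := Subtype.ext (funext fun x => mul_zero _)
          map_add' s t := Subtype.ext (funext fun x => mul_add _ _ _) }
      naturality _ _ _ := rfl }
    fun _ _ _ => Subtype.ext (funext fun x => mul_left_comm _ _ _)

end TwistingSheaf

noncomputable instance modulesHasFiniteBiproducts (Y : Scheme) :
    HasFiniteBiproducts Y.Modules :=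
  Abelian.hasFiniteBiproducts

/-- The grading of `T = ℂ[y₀, y₁, y₂]` by degree. -/
abbrev planeGrading : ℕ → Submodule ℂ (MvPolynomial (Fin 3) ℂ) :=
  MvPolynomial.homogeneousSubmodule (Fin 3) ℂ

noncomputable instance planeGradedRing : GradedRing planeGrading := MvPolynomial.gradedAlgebra

/-- The complex projective plane `ℙ² = Proj ℂ[y₀, y₁, y₂]`. -/
noncomputable abbrev ProjPlane : Scheme := Proj planeGrading

/-- The line bundle `𝒪(n)` on the complex projective plane. -/
noncomputable abbrev planeTwist (n : ℤ) : ProjPlane.Modules := twistingSheaf planeGrading n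

/-- A line arrangement in the complex projective plane: a finite set of distinct lines, the line
`v₀ y₀ + v₁ y₁ + v₂ y₂ = 0` being given by its vector of coefficients `v`. -/
structure LineArrangement where
  forms : Finset (Fin 3 → ℂ)
  ne_zero : ∀ v ∈ forms, v ≠ 0
  not_proportional : ∀ v ∈ forms, ∀ w ∈ forms, ∀ c : ℂ, w = c • v → w = v

namespace LineArrangement

open MvPolynomial

/-- The linear form `v₀ y₀ + v₁ y₁ + v₂ y₂`. -/
noncomputable def linearForm (v : Fin 3 → ℂ) : MvPolynomial (Fin 3) ℂ := ∑ i, C (v i) * X i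

/-- The polynomial `f_𝓐` that defines the arrangement: the product of its linear forms. -/
noncomputable def definingPolynomial (𝓐 : LineArrangement) : MvPolynomial (Fin 3) ℂ :=
  ∏ v ∈ 𝓐.forms, linearForm v

lemma definingPolynomial_isHomogeneous (𝓐 : LineArrangement) :
    𝓐.definingPolynomial.IsHomogeneous 𝓐.forms.card := by
  have h : 𝓐.definingPolynomial.IsHomogeneous (∑ v ∈ 𝓐.forms, 1) :=
    IsHomogeneous.prod _ _ _ fun v _ => IsHomogeneous.sum _ _ _ fun i _ => by
      simpa using (isHomogeneous_C (Fin 3) (v i)).mul (isHomogeneous_X ℂ i)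
  simpa using h

/-- The gradient map `[∂₀ f_𝓐, ∂₁ f_𝓐, ∂₂ f_𝓐] : 𝒪³ ⟶ 𝒪(d - 1)`, where `d` is the number of
lines. -/
noncomputable def gradient (𝓐 : LineArrangement) :
    (⨁ fun _ : Fin 3 => planeTwist 0) ⟶ planeTwist ((𝓐.forms.card - 1 : ℕ) : ℤ) :=
  biproduct.desc fun i => twistMul planeGrading (pderiv i 𝓐.definingPolynomial)
    𝓐.definingPolynomial_isHomogeneous.pderiv 0 _ (zero_add _)

/-- The derivation bundle `𝓓_𝓐`, the kernel of the gradient map. -/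
noncomputable def derivationBundle (𝓐 : LineArrangement) : ProjPlane.Modules := kernel 𝓐.gradient

/-- `𝓐` is free with splitting type (exponents) `(a, b)`: the derivation bundle is isomorphic to
`𝒪(-a) ⊕ 𝒪(-b)`. -/
def IsFreeWithSplittingType (𝓐 : LineArrangement) (a b : ℕ) : Prop :=
  Nonempty (𝓐.derivationBundle ≅ planeTwist (-(a : ℤ)) ⊞ planeTwist (-(b : ℤ)))

end LineArrangement

/-- The first nonzero coordinate is `1`. -/
def IsNormalized (v : Fin 3 → ℂ) : Prop :=
  v 0 = 1 ∨ (v 0 = 0 ∧ v 1 = 1) ∨ (v 0 = 0 ∧ v 1 = 0 ∧ v 2 = 1)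

lemma IsNormalized.ne_zero {v : Fin 3 → ℂ} (hv : IsNormalized v) : v ≠ 0 := by
  rintro rfl
  simp [IsNormalized] at hv

lemma IsNormalized.eq_of_smul {v w : Fin 3 → ℂ} (hv : IsNormalized v) (hw : IsNormalized w)
    (c : ℂ) (h : w = c • v) : w = v := by
  subst h
  have hc : c = 1 := by
    simp only [IsNormalized, Pi.smul_apply, smul_eq_mul] at hv hw
    rcases hv with h | ⟨h, h'⟩ | ⟨h, h', h''⟩ <;>
      rcases hw with g | ⟨g, g'⟩ | ⟨g, g', g''⟩ <;> simp_all
  rw [hc, one_smul]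

/-- The arrangement given by a finite set of normalized coefficient vectors. -/
def LineArrangement.ofNormalized (F : Finset (Fin 3 → ℂ)) (hF : ∀ v ∈ F, IsNormalized v) :
    LineArrangement where
  forms := F
  ne_zero v hv := (hF v hv).ne_zero
  not_proportional v hv w hw := (hF v hv).eq_of_smul (hF w hw)

/-- The line `x = i z`. -/
def verticalLine (i : ℤ) : Fin 3 → ℂ := ![1, 0, -i]

/-- The line `y = i z`. -/
def horizontalLine (i : ℤ) : Fin 3 → ℂ := ![0, 1, -i]

/-- The line `x - y + i z = 0`. -/
def diagonalLine (i : ℤ) : Fin 3 → ℂ := ![1, -1, i]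

/-- The line `x + y + i z = 0`. -/
def antidiagonalLine (i : ℤ) : Fin 3 → ℂ := ![1, 1, i]

/-- The line `z = 0`. -/
def lineAtInfinity : Fin 3 → ℂ := ![0, 0, 1]

open Classical in
/-- The lines of the tic-tac-toe arrangement of type `(k, j)`. -/
noncomputable def ticTacToeForms (k j : ℕ) : Finset (Fin 3 → ℂ) :=
  (Finset.Icc (-(k : ℤ)) k).image verticalLine ∪ (Finset.Icc (-(k : ℤ)) k).image horizontalLine ∪
    (Finset.Icc (-(j : ℤ)) j).image diagonalLine ∪
      (Finset.Icc (-(j : ℤ)) j).image antidiagonalLine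

lemma isNormalized_of_mem_ticTacToeForms (k j : ℕ) :
    ∀ v ∈ ticTacToeForms k j, IsNormalized v := by
  intro v hv
  simp only [ticTacToeForms, Finset.mem_union, Finset.mem_image] at hv
  rcases hv with ((⟨i, -, rfl⟩ | ⟨i, -, rfl⟩) | ⟨i, -, rfl⟩) | ⟨i, -, rfl⟩ <;>
    simp [IsNormalized, verticalLine, horizontalLine, diagonalLine, antidiagonalLine]

/-- The tic-tac-toe arrangement of type `(k, j)`. -/
noncomputable def ticTacToe (k j : ℕ) : LineArrangement :=
  .ofNormalized (ticTacToeForms k j) (isNormalized_of_mem_ticTacToeForms k j)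

open Classical in
/-- The complete tic-tac-toe arrangement of type `(k, j)`: the tic-tac-toe arrangement together
with the line at infinity. -/
noncomputable def completeTicTacToe (k j : ℕ) : LineArrangement :=
  .ofNormalized (insert lineAtInfinity (ticTacToe k j).forms) <| by
    intro v hv
    rcases Finset.mem_insert.mp hv with rfl | hv
    · simp [IsNormalized, lineAtInfinity]
    · exact isNormalized_of_mem_ticTacToeForms k j v hv

/-! The derivation bundle is the sheaf of syzygies of the gradient of the defining polynomial `f`.
If the graded module of polynomial syzygies has a homogeneous basis of degrees `a` and `b`, the same
two vectors trivialise the syzygies locally, because the coefficients of a local section are unique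
and hence glue; this gives `𝒪(-a) ⊞ 𝒪(-b)` (`IsSyzygyBasis.nonempty_kernel_iso`).

Such a basis comes from Saito's criterion. Work with the affine lines only and with vector fields
`(p, q, 0)`, which are automatically tangent to `z = 0`. If two fields tangent to all affine lines
have determinant a nonzero multiple of the product of the affine forms, then together with the Euler
field they have determinant a nonzero multiple of `f`. Subtracting multiples of the Euler field
moves them into the syzygies, and Cramer's rule shows that they generate
(`HasSaitoBasis.exists_isSyzygyBasis`).

Saito bases are built line by line with an addition theorem (`HasSaitoBasis.addition`): if the
exponents are `(a, b)` and a new line meets the old ones in exactly `b` affine points, the new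
exponents are `(a + 1, b)`. The grid has exponents `(2k+1, 2k+1)` by an explicit basis. The central
diagonal and anti-diagonal each have `2k+1` crossings, giving `(2k+1, 2k+3)`. From stage `j - 1` to
stage `j`, each of the four new lines has `2k+1+2j` crossings (`card_doubledCrossings`), which is
the larger exponent of stage `j - 1`; so that exponent stays fixed and the smaller one rises by four
to `2k+3+2j`. -/

/-! ### Local sections of the syzygy sheaf on `Proj` -/

section TwistedKernel

universe u

variable {A σ : Type u} [CommRing A] [SetLike σ A] [AddSubgroupClass σ A] {𝒜 : ℕ → σ}
  [GradedRing 𝒜]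

/-- The germs of a section of `𝒪(n)`. -/
def twistVal {n : ℤ} {U : (Proj 𝒜).Opens} (s : Γ(twistingSheaf 𝒜 n, U)) (x : U) :
    ConeStalk 𝒜 x.1 :=
  (show twistSections 𝒜 n U from s).1 x

lemma twistVal_ext {n : ℤ} {U : (Proj 𝒜).Opens} {s t : Γ(twistingSheaf 𝒜 n, U)}
    (h : ∀ x, twistVal s x = twistVal t x) : s = t :=
  Subtype.ext (funext h)

lemma twistVal_add {n : ℤ} {U : (Proj 𝒜).Opens} (s t : Γ(twistingSheaf 𝒜 n, U)) (x : U) :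
    twistVal (s + t) x = twistVal s x + twistVal t x := rfl

lemma twistVal_smul {n : ℤ} {U : (Proj 𝒜).Opens} (r : Γ(Proj 𝒜, U))
    (s : Γ(twistingSheaf 𝒜 n, U)) (x : U) :
    twistVal (r • s) x = HomogeneousLocalization.val
      ((show (ProjectiveSpectrum.Proj.structureSheaf 𝒜).1.obj (op U) from r).1 x) *
        twistVal s x := rfl

lemma twistVal_map {n : ℤ} {U V : (Proj 𝒜).Opens} (i : U ⟶ V)
    (s : Γ(twistingSheaf 𝒜 n, V)) (x : U) :
    twistVal ((twistingSheaf 𝒜 n).presheaf.map i.op s) x = twistVal s ⟨x.1, i.le x.2⟩ := rfl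

/-- Finitely many fractions are brought to a common denominator near a point. The bound `N ≤ e` is
there so that later degrees such as `e - a` are genuine differences of natural numbers. -/
lemma exists_common_fraction {ι : Type*} [Finite ι] {U : (Proj 𝒜).Opens}
    (s : ι → Γ(twistingSheaf 𝒜 0, U)) (x : U) (N : ℕ) :
    ∃ (V : (Proj 𝒜).Opens) (_ : x.1 ∈ V) (hVU : V ≤ U) (e : ℕ) (num : ι → A) (den : A),
      N ≤ e ∧ (∀ i, num i ∈ 𝒜 e) ∧ den ∈ 𝒜 e ∧ ∀ y : V, ∃ hd, ∀ i,
        twistVal (s i) ⟨y.1, hVU y.2⟩ = Localization.mk (num i) ⟨den, hd⟩ := by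
  classical
  cases nonempty_fintype ι
  have key : ∀ S : Finset ι, ∃ (V : (Proj 𝒜).Opens) (_ : x.1 ∈ V) (hVU : V ≤ U) (e : ℕ)
      (num : ι → A) (den : A), N ≤ e ∧ (∀ i, num i ∈ 𝒜 e) ∧ den ∈ 𝒜 e ∧ ∀ y : V, ∃ hd,
        ∀ i ∈ S, twistVal (s i) ⟨y.1, hVU y.2⟩ = Localization.mk (num i) ⟨den, hd⟩ := by
    intro S
    induction S using Finset.induction_on with
    | empty =>
      obtain ⟨m, hm, c, hc, hcx⟩ := exists_homogeneous_notMem 𝒜 x.1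
      -- The power `c ^ N` serves only to push the degree of the denominator above `N`.
      refine ⟨U ⊓ ProjectiveSpectrum.basicOpen 𝒜 c, ⟨x.2, hcx⟩, inf_le_left, N * m, 0, c ^ N,
        Nat.le_mul_of_pos_right _ hm, fun _ => zero_mem _,
        by simpa using SetLike.pow_mem_graded N hc, fun y => ⟨?_, by simp⟩⟩
      exact Submonoid.pow_mem _ y.2.2 _
    | insert i S hi ih =>
      obtain ⟨V, hV, hVU, e, num, den, hN, hnum, hden, h⟩ := ih
      obtain ⟨W, hW, iW, p, q, a, b, ha, hb, hpq, h'⟩ :=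
        (show twistSections 𝒜 0 U from s i).2 x
      obtain rfl : p = q := by simpa using hpq
      refine ⟨V ⊓ W, ⟨hV, hW⟩, inf_le_left.trans hVU, e + p,
        fun l => if l = i then den * a else num l * b, den * b, by omega, fun l => ?_,
        SetLike.mul_mem_graded hden hb, fun y => ?_⟩
      · dsimp only
        split_ifs
        · exact SetLike.mul_mem_graded hden ha
        · exact SetLike.mul_mem_graded (hnum l) hb
      · obtain ⟨h1, h2⟩ := h ⟨y.1, y.2.1⟩
        obtain ⟨h3, h4⟩ := h' ⟨y.1, y.2.2⟩
        refine ⟨mul_mem h1 h3, fun l hl => ?_⟩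
        dsimp only
        split_ifs with hli
        · subst hli
          refine (show twistVal (s l) _ = _ from h4).trans ?_
          rw [Localization.mk_eq_mk_iff, Localization.r_iff_exists]
          exact ⟨1, by simp; ring⟩
        · refine (h2 l (Finset.mem_of_mem_insert_of_ne hl hli)).trans ?_
          rw [Localization.mk_eq_mk_iff, Localization.r_iff_exists]
          exact ⟨1, by simp; ring⟩
  obtain ⟨V, hV, hVU, e, num, den, hN, hnum, hden, h⟩ := key Finset.univ
  refine ⟨V, hV, hVU, e, num, den, hN, hnum, hden, fun y => ?_⟩
  obtain ⟨hd, h⟩ := h y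
  exact ⟨hd, fun i => h i (Finset.mem_univ i)⟩

lemma coneStalk_injective [IsDomain A] (x : ProjectiveSpectrum.top 𝒜) :
    Function.Injective (algebraMap A (ConeStalk 𝒜 x)) :=
  have := x.isPrime
  IsLocalization.injective _ (Ideal.primeCompl_le_nonZeroDivisors x.asHomogeneousIdeal.toIdeal)

instance coneStalk_isDomain [IsDomain A] (x : ProjectiveSpectrum.top 𝒜) :
    IsDomain (ConeStalk 𝒜 x) :=
  have := x.isPrime
  IsLocalization.isDomain_localization
    (Ideal.primeCompl_le_nonZeroDivisors x.asHomogeneousIdeal.toIdeal)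

/-- `θ₁, θ₂` is a homogeneous basis of the syzygies of `F`. -/
structure IsSyzygyBasis (𝒜 : ℕ → σ) (F : Fin 3 → A) (a b : ℕ) (θ₁ θ₂ : Fin 3 → A) : Prop where
  mem₁ : ∀ i, θ₁ i ∈ 𝒜 a
  mem₂ : ∀ i, θ₂ i ∈ 𝒜 b
  sum₁ : ∑ i, F i * θ₁ i = 0
  sum₂ : ∑ i, F i * θ₂ i = 0
  indep : ∃ i j, θ₁ i * θ₂ j - θ₁ j * θ₂ i ≠ 0
  span : ∀ w : Fin 3 → A, ∑ i, F i * w i = 0 → ∃ t₁ t₂, ∀ i, w i = θ₁ i * t₁ + θ₂ i * t₂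

namespace IsSyzygyBasis

variable {F θ₁ θ₂ : Fin 3 → A} {a b : ℕ}

/-- A nonzero minor of `θ₁, θ₂` stays nonzero in every stalk, since `A` is a domain; eliminating
with it determines both coefficients. All gluing below rests on this uniqueness. -/
lemma eq_of_germ_eq [IsDomain A] (h : IsSyzygyBasis 𝒜 F a b θ₁ θ₂) {x : ProjectiveSpectrum.top 𝒜}
    {s t s' t' : ConeStalk 𝒜 x}
    (H : ∀ i, algebraMap A _ (θ₁ i) * s + algebraMap A _ (θ₂ i) * t =
      algebraMap A _ (θ₁ i) * s' + algebraMap A _ (θ₂ i) * t') : s = s' ∧ t = t' := by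
  obtain ⟨i, j, hij⟩ := h.indep
  have hne : algebraMap A (ConeStalk 𝒜 x) (θ₁ i) * algebraMap A _ (θ₂ j) -
      algebraMap A _ (θ₁ j) * algebraMap A _ (θ₂ i) ≠ 0 := by
    rw [← map_mul, ← map_mul, ← map_sub]
    exact (map_ne_zero_iff _ (coneStalk_injective x)).2 hij
  constructor <;> refine mul_left_cancel₀ hne ?_
  · linear_combination algebraMap A (ConeStalk 𝒜 x) (θ₂ j) * H i -
      algebraMap A (ConeStalk 𝒜 x) (θ₂ i) * H j
  · linear_combination algebraMap A (ConeStalk 𝒜 x) (θ₁ i) * H j -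
      algebraMap A (ConeStalk 𝒜 x) (θ₁ j) * H i

/-- The coefficients supplied by `span` need not be homogeneous; taking the degree `e` component of
the relation replaces them by homogeneous ones. -/
lemma exists_homogeneous (h : IsSyzygyBasis 𝒜 F a b θ₁ θ₂) {e : ℕ} (ha : a ≤ e) (hb : b ≤ e)
    {w : Fin 3 → A} (hw : ∀ i, w i ∈ 𝒜 e) (hFw : ∑ i, F i * w i = 0) :
    ∃ t₁ ∈ 𝒜 (e - a), ∃ t₂ ∈ 𝒜 (e - b), ∀ i, w i = θ₁ i * t₁ + θ₂ i * t₂ := by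
  obtain ⟨t₁, t₂, ht⟩ := h.span w hFw
  refine ⟨_, (DirectSum.decompose 𝒜 t₁ (e - a)).2, _, (DirectSum.decompose 𝒜 t₂ (e - b)).2,
    fun i => ?_⟩
  have := congr((DirectSum.decompose 𝒜 $(ht i) e : A))
  rw [DirectSum.decompose_of_mem_same _ (hw i), DirectSum.decompose_add, DirectSum.add_apply,
    AddMemClass.coe_add, DirectSum.coe_decompose_mul_of_left_mem_of_le 𝒜 (h.mem₁ i) ha,
    DirectSum.coe_decompose_mul_of_left_mem_of_le 𝒜 (h.mem₂ i) hb] at this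
  exact this

lemma exists_local [IsDomain A] (h : IsSyzygyBasis 𝒜 F a b θ₁ θ₂) {U : (Proj 𝒜).Opens}
    (s : Fin 3 → Γ(twistingSheaf 𝒜 0, U))
    (hs : ∀ x : U, ∑ i, algebraMap A (ConeStalk 𝒜 x.1) (F i) * twistVal (s i) x = 0) (x : U) :
    ∃ (V : (Proj 𝒜).Opens) (_ : x.1 ∈ V) (hVU : V ≤ U) (e : ℕ) (t₁ t₂ den : A),
      a ≤ e ∧ b ≤ e ∧ t₁ ∈ 𝒜 (e - a) ∧ t₂ ∈ 𝒜 (e - b) ∧ den ∈ 𝒜 e ∧ ∀ y : V, ∃ hd, ∀ i,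
        algebraMap A (ConeStalk 𝒜 y.1) (θ₁ i) * Localization.mk t₁ ⟨den, hd⟩ +
        algebraMap A (ConeStalk 𝒜 y.1) (θ₂ i) * Localization.mk t₂ ⟨den, hd⟩ =
          twistVal (s i) ⟨y.1, hVU y.2⟩ := by
  obtain ⟨V, hV, hVU, e, num, den, hN, hnum, hden, hV'⟩ :=
    exists_common_fraction s x (max a b)
  -- Clearing the denominator at the single point `x` gives a relation in `A` itself, as `A` embeds
  -- in the stalk. It therefore governs the whole neighbourhood.
  have hF : ∑ i, F i * num i = 0 := by
    obtain ⟨hd, hx⟩ := hV' ⟨x.1, hV⟩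
    have h1 := hs x
    have h2 : ∀ i, twistVal (s i) x * algebraMap A (ConeStalk 𝒜 x.1) den =
        algebraMap A _ (num i) := fun i => by
      rw [show twistVal (s i) x = _ from hx i, Localization.mk_eq_mk', mul_comm]
      exact IsLocalization.mk'_spec' (ConeStalk 𝒜 x.1) (num i) ⟨den, hd⟩
    apply coneStalk_injective x.1
    rw [map_zero, map_sum]
    calc _ = (∑ i, algebraMap A (ConeStalk 𝒜 x.1) (F i) * twistVal (s i) x) *
          algebraMap A _ den := by
            rw [Finset.sum_mul]
            exact Finset.sum_congr rfl fun i _ => by rw [map_mul, ← h2, mul_assoc]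
      _ = 0 := by rw [h1, zero_mul]
  obtain ⟨t₁, ht₁, t₂, ht₂, ht⟩ := h.exists_homogeneous ((le_max_left a b).trans hN)
    ((le_max_right a b).trans hN) hnum hF
  refine ⟨V, hV, hVU, e, t₁, t₂, den, (le_max_left a b).trans hN, (le_max_right a b).trans hN,
    ht₁, ht₂, hden, fun y => ?_⟩
  obtain ⟨hd, hy⟩ := hV' y
  refine ⟨hd, fun i => ?_⟩
  rw [hy i, ht i, ← Localization.mk_one_eq_algebraMap, ← Localization.mk_one_eq_algebraMap,
    Localization.mk_mul, Localization.mk_mul, one_mul, Localization.add_mk_self]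

lemma exists_sections [IsDomain A] (h : IsSyzygyBasis 𝒜 F a b θ₁ θ₂) {U : (Proj 𝒜).Opens}
    (s : Fin 3 → Γ(twistingSheaf 𝒜 0, U))
    (hs : ∀ x : U, ∑ i, algebraMap A (ConeStalk 𝒜 x.1) (F i) * twistVal (s i) x = 0) :
    ∃ t : Γ(twistingSheaf 𝒜 (-a), U) × Γ(twistingSheaf 𝒜 (-b), U), ∀ i x,
      algebraMap A (ConeStalk 𝒜 x.1) (θ₁ i) * twistVal t.1 x +
        algebraMap A (ConeStalk 𝒜 x.1) (θ₂ i) * twistVal t.2 x = twistVal (s i) x := by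
  have hpt : ∀ x : U, ∃ t : ConeStalk 𝒜 x.1 × ConeStalk 𝒜 x.1, ∀ i,
      algebraMap A (ConeStalk 𝒜 x.1) (θ₁ i) * t.1 +
        algebraMap A (ConeStalk 𝒜 x.1) (θ₂ i) * t.2 = twistVal (s i) x := fun x => by
    obtain ⟨V, hV, hVU, e, t₁, t₂, den, -, -, -, -, -, hy⟩ := h.exists_local s hs x
    obtain ⟨hd, hy⟩ := hy ⟨x.1, hV⟩
    exact ⟨(_, _), hy⟩
  choose t ht using hpt
  -- Pointwise choices agree with the local fractions by uniqueness, so the chosen families are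
  -- sections.
  have hloc : ∀ x : U, ∃ (V : (Proj 𝒜).Opens) (_ : x.1 ∈ V) (hVU : V ≤ U) (e : ℕ)
      (t₁ t₂ den : A), a ≤ e ∧ b ≤ e ∧ t₁ ∈ 𝒜 (e - a) ∧ t₂ ∈ 𝒜 (e - b) ∧ den ∈ 𝒜 e ∧
      ∀ y : V, ∃ hd, (t ⟨y.1, hVU y.2⟩).1 = Localization.mk t₁ ⟨den, hd⟩ ∧
        (t ⟨y.1, hVU y.2⟩).2 = Localization.mk t₂ ⟨den, hd⟩ := fun x => by
    obtain ⟨V, hV, hVU, e, t₁, t₂, den, h1, h2, h3, h4, h5, hy⟩ := h.exists_local s hs x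
    refine ⟨V, hV, hVU, e, t₁, t₂, den, h1, h2, h3, h4, h5, fun y => ?_⟩
    obtain ⟨hd, hy⟩ := hy y
    exact ⟨hd, h.eq_of_germ_eq fun i => (ht _ i).trans (hy i).symm⟩
  let T₁ : twistSections 𝒜 (-a) U := ⟨fun x => (t x).1, fun x => by
    obtain ⟨V, hV, hVU, e, t₁, t₂, den, h1, h2, h3, h4, h5, hy⟩ := hloc x
    exact ⟨V, hV, homOfLE hVU, e - a, e, t₁, den, h3, h5, by omega, fun y =>
      ⟨(hy y).1, (hy y).2.1⟩⟩⟩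
  let T₂ : twistSections 𝒜 (-b) U := ⟨fun x => (t x).2, fun x => by
    obtain ⟨V, hV, hVU, e, t₁, t₂, den, h1, h2, h3, h4, h5, hy⟩ := hloc x
    exact ⟨V, hV, homOfLE hVU, e - b, e, t₂, den, h4, h5, by omega, fun y =>
      ⟨(hy y).1, (hy y).2.2⟩⟩⟩
  exact ⟨(T₁, T₂), fun i x => ht x i⟩

end IsSyzygyBasis

end TwistedKernel

/-! ### Splitting of the kernel sheaf -/

section TwistedKernelIso

universe u

variable {A σ : Type u} [CommRing A] [SetLike σ A] [AddSubgroupClass σ A] {𝒜 : ℕ → σ}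
  [GradedRing 𝒜]

lemma modules_sum_app {X : Scheme.{u}} {M N : X.Modules} {ι : Type*} (S : Finset ι)
    (f : ι → (M ⟶ N)) (U : X.Opens) (s : Γ(M, U)) :
    (∑ i ∈ S, f i).app U s = ∑ i ∈ S, (f i).app U s := by
  classical
  induction S using Finset.induction_on with
  | empty => rfl
  | insert i S hi ih =>
    rw [Finset.sum_insert hi, Finset.sum_insert hi, ← ih]; rfl

lemma twistVal_sum {n : ℤ} {U : (Proj 𝒜).Opens} {ι : Type*} (S : Finset ι)
    (s : ι → Γ(twistingSheaf 𝒜 n, U)) (x : U) :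
    twistVal (∑ i ∈ S, s i) x = ∑ i ∈ S, twistVal (s i) x := by
  classical
  induction S using Finset.induction_on with
  | empty => rfl
  | insert i S hi ih => rw [Finset.sum_insert hi, Finset.sum_insert hi, ← ih]; rfl

lemma modules_app_map {X : Scheme.{u}} {M N : X.Modules} (f : M ⟶ N) {U V : X.Opens} (i : U ⟶ V)
    (s : Γ(M, V)) : f.app U (M.presheaf.map i.op s) = N.presheaf.map i.op (f.app V s) :=
  congr($(f.mapPresheaf.naturality i.op) s)

/-- A morphism to a twisting sheaf, given by its values on sections. -/
noncomputable def homToTwist {M : (Proj 𝒜).Modules} {n : ℤ}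
    (f : ∀ U : (Proj 𝒜).Opens, Γ(M, U) → Γ(twistingSheaf 𝒜 n, U))
    (hadd : ∀ U s t, f U (s + t) = f U s + f U t)
    (hsmul : ∀ (U : (Proj 𝒜).Opens) (r : Γ(Proj 𝒜, U)) s, f U (r • s) = r • f U s)
    (hmap : ∀ (U V : (Proj 𝒜).Opens) (i : U ⟶ V) s,
      f U (M.presheaf.map i.op s) = (twistingSheaf 𝒜 n).presheaf.map i.op (f V s)) :
    M ⟶ twistingSheaf 𝒜 n where
  val := PresheafOfModules.homMk
    { app U := AddCommGrpCat.ofHom (AddMonoidHom.mk' (f U.unop) (hadd U.unop))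
      naturality U V i := by
        ext s
        exact hmap V.unop U.unop i.unop s }
    fun U r s => hsmul U.unop r s

namespace IsSyzygyBasis

variable {F θ₁ θ₂ : Fin 3 → A} {a b : ℕ}

lemma section_ext [IsDomain A] (h : IsSyzygyBasis 𝒜 F a b θ₁ θ₂) {U : (Proj 𝒜).Opens}
    {t t' : Γ(twistingSheaf 𝒜 (-a), U) × Γ(twistingSheaf 𝒜 (-b), U)}
    (H : ∀ i (x : U), algebraMap A (ConeStalk 𝒜 x.1) (θ₁ i) * twistVal t.1 x +
        algebraMap A (ConeStalk 𝒜 x.1) (θ₂ i) * twistVal t.2 x =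
      algebraMap A (ConeStalk 𝒜 x.1) (θ₁ i) * twistVal t'.1 x +
        algebraMap A (ConeStalk 𝒜 x.1) (θ₂ i) * twistVal t'.2 x) : t = t' :=
  Prod.ext (twistVal_ext fun x => (h.eq_of_germ_eq fun i => H i x).1)
    (twistVal_ext fun x => (h.eq_of_germ_eq fun i => H i x).2)

/-- Coefficients are chosen section by section. Uniqueness makes the choice additive, linear over
regular functions and compatible with restriction, so it is a morphism. -/
lemma exists_lift [IsDomain A] (h : IsSyzygyBasis 𝒜 F a b θ₁ θ₂) {d : ℕ} (hF : ∀ i, F i ∈ 𝒜 d)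
    {M : (Proj 𝒜).Modules} (m : Fin 3 → (M ⟶ twistingSheaf 𝒜 0))
    (hm : ∑ i, m i ≫ twistMul 𝒜 (F i) (hF i) 0 d (zero_add _) = 0) :
    ∃ (l₁ : M ⟶ twistingSheaf 𝒜 (-a)) (l₂ : M ⟶ twistingSheaf 𝒜 (-b)), ∀ i,
      l₁ ≫ twistMul 𝒜 (θ₁ i) (h.mem₁ i) (-a) 0 (neg_add_cancel _) +
        l₂ ≫ twistMul 𝒜 (θ₂ i) (h.mem₂ i) (-b) 0 (neg_add_cancel _) = m i := by
  have key : ∀ (U : (Proj 𝒜).Opens) (s : Γ(M, U)),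
      ∃ t : Γ(twistingSheaf 𝒜 (-a), U) × Γ(twistingSheaf 𝒜 (-b), U), ∀ i x,
      algebraMap A (ConeStalk 𝒜 x.1) (θ₁ i) * twistVal t.1 x +
        algebraMap A (ConeStalk 𝒜 x.1) (θ₂ i) * twistVal t.2 x =
          twistVal ((m i).app U s) x := fun U s => by
    refine h.exists_sections (fun i => (m i).app U s) fun x => ?_
    have h1 : twistVal ((∑ i, m i ≫ twistMul 𝒜 (F i) (hF i) 0 d (zero_add _)).app U s) x = 0 := by
      rw [hm]; rfl
    rw [modules_sum_app, twistVal_sum] at h1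
    exact h1
  choose t ht using key
  have hadd : ∀ U s s', t U (s + s') = t U s + t U s' := fun U s s' =>
    h.section_ext fun i x => by
      rw [ht, map_add, twistVal_add, ← ht, ← ht, Prod.fst_add, Prod.snd_add, twistVal_add,
        twistVal_add]
      ring
  have hsmul : ∀ (U : (Proj 𝒜).Opens) (r : Γ(Proj 𝒜, U)) s,
      t U (r • s) = (r • (t U s).1, r • (t U s).2) := fun U r s =>
    h.section_ext fun i x => by
      rw [ht, Scheme.Modules.Hom.app_smul, twistVal_smul, ← ht, twistVal_smul, twistVal_smul]
      ring
  have hmap : ∀ (U V : (Proj 𝒜).Opens) (i : U ⟶ V) s, t U (M.presheaf.map i.op s) =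
      ((twistingSheaf 𝒜 (-a)).presheaf.map i.op (t V s).1,
        (twistingSheaf 𝒜 (-b)).presheaf.map i.op (t V s).2) := fun U V i s =>
    h.section_ext fun j x => by
      rw [ht, modules_app_map, twistVal_map, twistVal_map, twistVal_map]
      exact (ht V s j ⟨x.1, i.le x.2⟩).symm
  refine ⟨homToTwist (fun U s => (t U s).1) (fun U s s' => congr(Prod.fst $(hadd U s s')))
    (fun U r s => congr(Prod.fst $(hsmul U r s))) (fun U V i s => congr(Prod.fst $(hmap U V i s))),
    homToTwist (fun U s => (t U s).2) (fun U s s' => congr(Prod.snd $(hadd U s s')))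
    (fun U r s => congr(Prod.snd $(hsmul U r s))) (fun U V i s => congr(Prod.snd $(hmap U V i s))),
    fun i => ?_⟩
  ext U s
  exact twistVal_ext fun x => ht U s i x

/-- The two syzygies, as a morphism `𝒪(-a) ⊞ 𝒪(-b) ⟶ 𝒪³`. -/
noncomputable def toFree (h : IsSyzygyBasis 𝒜 F a b θ₁ θ₂) :
    twistingSheaf 𝒜 (-a) ⊞ twistingSheaf 𝒜 (-b) ⟶ ⨁ fun _ : Fin 3 => twistingSheaf 𝒜 0 :=
  biprod.desc
    (biproduct.lift fun i => twistMul 𝒜 (θ₁ i) (h.mem₁ i) (-a) 0 (neg_add_cancel _))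
    (biproduct.lift fun i => twistMul 𝒜 (θ₂ i) (h.mem₂ i) (-b) 0 (neg_add_cancel _))

lemma twistMul_sum_eq_zero {e d : ℕ} {n m : ℤ} {θ : Fin 3 → A} (hθ : ∀ i, θ i ∈ 𝒜 e)
    (hF : ∀ i, F i ∈ 𝒜 d) (h0 : n + e = 0) (hm : 0 + d = m) (hs : ∑ i, F i * θ i = 0) :
    ∑ i, twistMul 𝒜 (θ i) (hθ i) n 0 h0 ≫ twistMul 𝒜 (F i) (hF i) 0 m hm = 0 := by
  ext U s
  refine twistVal_ext fun x => ?_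
  rw [modules_sum_app, twistVal_sum]
  calc _ = ∑ i, algebraMap A (ConeStalk 𝒜 x.1) (F i) *
        (algebraMap A (ConeStalk 𝒜 x.1) (θ i) * twistVal s x) := rfl
    _ = algebraMap A (ConeStalk 𝒜 x.1) (∑ i, F i * θ i) * twistVal s x := by
        rw [map_sum, Finset.sum_mul]
        exact Finset.sum_congr rfl fun i _ => by rw [map_mul, mul_assoc]
    _ = 0 := by rw [hs, map_zero, zero_mul]

lemma toFree_comp (h : IsSyzygyBasis 𝒜 F a b θ₁ θ₂) {d : ℕ} (hF : ∀ i, F i ∈ 𝒜 d) :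
    h.toFree ≫ biproduct.desc (fun i => twistMul 𝒜 (F i) (hF i) 0 d (zero_add _)) = 0 := by
  refine biprod.hom_ext' _ _ ?_ ?_
  · rw [toFree, biprod.inl_desc_assoc, biproduct.lift_desc, comp_zero]
    exact twistMul_sum_eq_zero h.mem₁ hF _ _ h.sum₁
  · rw [toFree, biprod.inr_desc_assoc, biproduct.lift_desc, comp_zero]
    exact twistMul_sum_eq_zero h.mem₂ hF _ _ h.sum₂

lemma toFree_π (h : IsSyzygyBasis 𝒜 F a b θ₁ θ₂) {M : (Proj 𝒜).Modules}
    (l : M ⟶ twistingSheaf 𝒜 (-a) ⊞ twistingSheaf 𝒜 (-b)) (i : Fin 3) :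
    (l ≫ h.toFree) ≫ biproduct.π _ i =
      (l ≫ biprod.fst) ≫ twistMul 𝒜 (θ₁ i) (h.mem₁ i) (-a) 0 (neg_add_cancel _) +
      (l ≫ biprod.snd) ≫ twistMul 𝒜 (θ₂ i) (h.mem₂ i) (-b) 0 (neg_add_cancel _) := by
  rw [toFree, biprod.desc_eq]
  simp [Preadditive.comp_add, Preadditive.add_comp]

lemma toFree_cancel [IsDomain A] (h : IsSyzygyBasis 𝒜 F a b θ₁ θ₂) {M : (Proj 𝒜).Modules}
    {l l' : M ⟶ twistingSheaf 𝒜 (-a) ⊞ twistingSheaf 𝒜 (-b)}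
    (H : l ≫ h.toFree = l' ≫ h.toFree) : l = l' := by
  have key : ∀ (U : (Proj 𝒜).Opens) (s : Γ(M, U)),
      ((l ≫ biprod.fst).app U s, (l ≫ biprod.snd).app U s) =
        ((l' ≫ biprod.fst).app U s, (l' ≫ biprod.snd).app U s) := fun U s =>
    h.section_ext fun i x => by
      have h1 := congr($H ≫ biproduct.π _ i)
      rw [h.toFree_π, h.toFree_π] at h1
      exact congr(twistVal (Scheme.Modules.Hom.app $h1 U s) x)
  refine biprod.hom_ext _ _ ?_ ?_ <;> ext U s
  · exact congr(Prod.fst $(key U s))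
  · exact congr(Prod.snd $(key U s))

/-- A homogeneous basis of the syzygies of `F` splits the kernel of `F : 𝒪³ ⟶ 𝒪(d)`. -/
theorem nonempty_kernel_iso [IsDomain A] (h : IsSyzygyBasis 𝒜 F a b θ₁ θ₂) {d : ℕ}
    (hF : ∀ i, F i ∈ 𝒜 d) :
    Nonempty (kernel (biproduct.desc fun i => twistMul 𝒜 (F i) (hF i) 0 d (zero_add _)) ≅
      twistingSheaf 𝒜 (-a) ⊞ twistingSheaf 𝒜 (-b)) := by
  have key : ∀ {M : (Proj 𝒜).Modules} (g : M ⟶ ⨁ fun _ : Fin 3 => twistingSheaf 𝒜 0),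
      g ≫ biproduct.desc (fun i => twistMul 𝒜 (F i) (hF i) 0 d (zero_add _)) = 0 →
      ∃ l, l ≫ h.toFree = g := fun {M} g hg => by
    obtain ⟨l₁, l₂, hl⟩ := h.exists_lift hF (fun i => g ≫ biproduct.π _ i) (by
      rw [biproduct.desc_eq, Preadditive.comp_sum] at hg
      simpa using hg)
    refine ⟨biprod.lift l₁ l₂, biproduct.hom_ext _ _ fun i => ?_⟩
    rw [h.toFree_π, biprod.lift_fst, biprod.lift_snd, hl]
  choose L hL using @key
  exact ⟨(kernelIsKernel _).conePointUniqueUpToIso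
    (KernelFork.IsLimit.ofι h.toFree (h.toFree_comp hF) (fun g hg => L g hg)
      (fun g hg => hL g hg) (fun g hg m hm => h.toFree_cancel (hm.trans (hL g hg).symm)))⟩

end IsSyzygyBasis

end TwistedKernelIso

/-! ### Determinants and Cramer's rule in rank three -/

section CrossProduct

variable {R : Type*} [CommRing R]

/-- The determinant with columns `u, v, w`. -/
def tripleProduct (u v w : Fin 3 → R) : R :=
  u 0 * (v 1 * w 2 - v 2 * w 1) - u 1 * (v 0 * w 2 - v 2 * w 0) + u 2 * (v 0 * w 1 - v 1 * w 0)

/-- Cramer's rule: `m i` times the determinant is a combination, with cofactors as coefficients, of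
the three pairings of `m` with the columns. -/
lemma dvd_smul_tripleProduct {l : R} {m u v w : Fin 3 → R} (hu : l ∣ ∑ i, m i * u i)
    (hv : l ∣ ∑ i, m i * v i) (hw : l ∣ ∑ i, m i * w i) (i : Fin 3) :
    l ∣ m i * tripleProduct u v w := by
  simp only [Fin.sum_univ_three] at hu hv hw
  obtain ⟨a, ha⟩ := hu
  obtain ⟨b, hb⟩ := hv
  obtain ⟨c, hc⟩ := hw
  fin_cases i <;> simp only [tripleProduct] <;> dsimp only [Fin.zero_eta, Fin.mk_one, Fin.reduceFinMk]
  · exact ⟨a * (v 1 * w 2 - v 2 * w 1) - b * (u 1 * w 2 - u 2 * w 1) +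
      c * (u 1 * v 2 - u 2 * v 1), by
        linear_combination (v 1 * w 2 - v 2 * w 1) * ha - (u 1 * w 2 - u 2 * w 1) * hb +
          (u 1 * v 2 - u 2 * v 1) * hc⟩
  · exact ⟨a * (v 2 * w 0 - v 0 * w 2) - b * (u 2 * w 0 - u 0 * w 2) +
      c * (u 2 * v 0 - u 0 * v 2), by
        linear_combination (v 2 * w 0 - v 0 * w 2) * ha - (u 2 * w 0 - u 0 * w 2) * hb +
          (u 2 * v 0 - u 0 * v 2) * hc⟩
  · exact ⟨a * (v 0 * w 1 - v 1 * w 0) - b * (u 0 * w 1 - u 1 * w 0) +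
      c * (u 0 * v 1 - u 1 * v 0), by
        linear_combination (v 0 * w 1 - v 1 * w 0) * ha - (u 0 * w 1 - u 1 * w 0) * hb +
          (u 0 * v 1 - u 1 * v 0) * hc⟩

variable [IsDomain R] {F E θ₁ θ₂ : Fin 3 → R} {f d c : R}

/-- Two vectors orthogonal to `F` have cross product proportional to `F`. -/
lemma cross_eq (h₁ : ∑ i, F i * θ₁ i = 0) (h₂ : ∑ i, F i * θ₂ i = 0)
    (hE : ∑ i, F i * E i = d * f) (hf : f ≠ 0) (hdet : tripleProduct E θ₁ θ₂ = c * f) :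
    d * (θ₁ 1 * θ₂ 2 - θ₁ 2 * θ₂ 1) = c * F 0 ∧ d * (θ₁ 2 * θ₂ 0 - θ₁ 0 * θ₂ 2) = c * F 1 ∧
      d * (θ₁ 0 * θ₂ 1 - θ₁ 1 * θ₂ 0) = c * F 2 := by
  simp only [Fin.sum_univ_three, tripleProduct] at *
  -- These three identities say that `F × (θ₁ × θ₂)` vanishes, being `(F · θ₂) θ₁ - (F · θ₁) θ₂`.
  have h01 : F 0 * (θ₁ 2 * θ₂ 0 - θ₁ 0 * θ₂ 2) = F 1 * (θ₁ 1 * θ₂ 2 - θ₁ 2 * θ₂ 1) := by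
    linear_combination θ₁ 2 * h₂ - θ₂ 2 * h₁
  have h12 : F 1 * (θ₁ 0 * θ₂ 1 - θ₁ 1 * θ₂ 0) = F 2 * (θ₁ 2 * θ₂ 0 - θ₁ 0 * θ₂ 2) := by
    linear_combination θ₁ 0 * h₂ - θ₂ 0 * h₁
  have h20 : F 2 * (θ₁ 1 * θ₂ 2 - θ₁ 2 * θ₂ 1) = F 0 * (θ₁ 0 * θ₂ 1 - θ₁ 1 * θ₂ 0) := by
    linear_combination θ₁ 1 * h₂ - θ₂ 1 * h₁
  refine ⟨mul_left_cancel₀ hf ?_, mul_left_cancel₀ hf ?_, mul_left_cancel₀ hf ?_⟩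
  · linear_combination -(θ₁ 1 * θ₂ 2 - θ₁ 2 * θ₂ 1) * hE + F 0 * hdet - E 1 * h01 + E 2 * h20
  · linear_combination -(θ₁ 2 * θ₂ 0 - θ₁ 0 * θ₂ 2) * hE + F 1 * hdet + E 0 * h01 - E 2 * h12
  · linear_combination -(θ₁ 0 * θ₂ 1 - θ₁ 1 * θ₂ 0) * hE + F 2 * hdet - E 0 * h20 + E 1 * h12

/-- Cramer's rule for vectors orthogonal to `F`. -/
lemma smul_eq_of_orthogonal (h₁ : ∑ i, F i * θ₁ i = 0) (h₂ : ∑ i, F i * θ₂ i = 0)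
    (hE : ∑ i, F i * E i = d * f) (hf : f ≠ 0) (hd : d ≠ 0)
    (hdet : tripleProduct E θ₁ θ₂ = c * f) {w : Fin 3 → R} (hw : ∑ i, F i * w i = 0) {t₁ t₂ : R}
    (ht₁ : tripleProduct E w θ₂ = f * t₁) (ht₂ : tripleProduct E θ₁ w = f * t₂) (i : Fin 3) :
    c * w i = θ₁ i * t₁ + θ₂ i * t₂ := by
  obtain ⟨x0, x1, x2⟩ := cross_eq h₁ h₂ hE hf hdet
  -- By `cross_eq`, `θ₁ × θ₂` is parallel to `F`, and `w` is orthogonal to `F`. In Cramer's identity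
  -- below the term along `E` thus drops out.
  have hz : tripleProduct w θ₁ θ₂ = 0 := by
    refine mul_left_cancel₀ hd ?_
    simp only [Fin.sum_univ_three, tripleProduct] at *
    linear_combination w 0 * x0 + w 1 * x1 + w 2 * x2 + c * hw
  refine mul_left_cancel₀ hf ?_
  have key : tripleProduct E θ₁ θ₂ * w i = tripleProduct w θ₁ θ₂ * E i +
      tripleProduct E w θ₂ * θ₁ i + tripleProduct E θ₁ w * θ₂ i := by
    fin_cases i <;> simp only [tripleProduct] <;>
      dsimp only [Fin.zero_eta, Fin.mk_one, Fin.reduceFinMk] <;> ring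
  rw [hz, ht₁, ht₂, hdet] at key
  linear_combination key

end CrossProduct

/-! ### Linear forms as primes, and tangency to lines -/

section LinearForms

open MvPolynomial LineArrangement

lemma linearForm_isHomogeneous (v : Fin 3 → ℂ) : (linearForm v).IsHomogeneous 1 :=
  IsHomogeneous.sum _ _ _ fun i _ => by
    simpa using (isHomogeneous_C (Fin 3) (v i)).mul (isHomogeneous_X ℂ i)

lemma pderiv_linearForm (v : Fin 3 → ℂ) (i : Fin 3) : pderiv i (linearForm v) = C (v i) := by
  fin_cases i <;> simp [linearForm, Fin.sum_univ_three, Derivation.leibniz, pderiv_X]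

lemma linearForm_ne_zero {v : Fin 3 → ℂ} (hv : v ≠ 0) : linearForm v ≠ 0 := by
  intro h
  refine hv (funext fun i => ?_)
  have := pderiv_linearForm v i
  rw [h, map_zero, eq_comm, C_eq_zero] at this
  exact this

lemma totalDegree_linearForm {v : Fin 3 → ℂ} (hv : v ≠ 0) : (linearForm v).totalDegree = 1 :=
  (linearForm_isHomogeneous v).totalDegree (linearForm_ne_zero hv)

lemma linearForm_prime {v : Fin 3 → ℂ} (hv : v ≠ 0) : Prime (linearForm v) := by
  refine (irreducible_of_totalDegree_eq_one (totalDegree_linearForm hv) fun x hx => ?_).prime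
  rw [isUnit_iff_ne_zero]
  rintro rfl
  refine linearForm_ne_zero hv (MvPolynomial.ext _ _ fun m => ?_)
  simpa using hx m

lemma exists_smul_of_linearForm_dvd {v w : Fin 3 → ℂ} (hv : v ≠ 0)
    (h : linearForm v ∣ linearForm w) : ∃ c : ℂ, w = c • v := by
  by_cases hw : w = 0
  · exact ⟨0, by simp [hw]⟩
  obtain ⟨g, hg⟩ := h
  have hg0 : g ≠ 0 := by
    rintro rfl
    exact linearForm_ne_zero hw (by simpa using hg)
  have hdeg := congr(MvPolynomial.totalDegree $hg)
  rw [totalDegree_mul_of_isDomain (linearForm_ne_zero hv) hg0, totalDegree_linearForm hv,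
    totalDegree_linearForm hw] at hdeg
  obtain ⟨c, rfl⟩ : ∃ c, g = C c := ⟨_, totalDegree_eq_zero_iff_eq_C.1 (by omega)⟩
  refine ⟨c, funext fun i => ?_⟩
  have := congr(pderiv i $hg)
  rw [pderiv_linearForm, mul_comm, pderiv_C_mul, pderiv_linearForm, ← C_mul] at this
  exact C_injective _ _ this

lemma linearForm_not_dvd {v w : Fin 3 → ℂ} (hv : IsNormalized v) (hw : IsNormalized w)
    (hvw : v ≠ w) : ¬ linearForm v ∣ linearForm w := fun h => by
  obtain ⟨c, hc⟩ := exists_smul_of_linearForm_dvd hv.ne_zero h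
  exact hvw (hv.eq_of_smul hw c hc).symm

lemma prod_linearForm_dvd {T : Finset (Fin 3 → ℂ)} (hT : ∀ v ∈ T, IsNormalized v)
    {g : MvPolynomial (Fin 3) ℂ} (h : ∀ v ∈ T, linearForm v ∣ g) :
    ∏ v ∈ T, linearForm v ∣ g := by
  refine Finset.prod_dvd_of_isRelPrime (fun v hv w hw hvw => ?_) h
  exact (linearForm_prime (hT v hv).ne_zero).irreducible.isRelPrime_iff_not_dvd.2
    (linearForm_not_dvd (hT v hv) (hT w hw) hvw)

lemma linearForm_not_dvd_prod {T : Finset (Fin 3 → ℂ)} (hT : ∀ v ∈ T, IsNormalized v)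
    {v : Fin 3 → ℂ} (hv : IsNormalized v) (hvT : v ∉ T) :
    ¬ linearForm v ∣ ∏ w ∈ T, linearForm w := fun h => by
  obtain ⟨w, hw, hd⟩ := (linearForm_prime hv.ne_zero).exists_mem_finset_dvd h
  exact linearForm_not_dvd hv (hT w hw) (fun h => hvT (h ▸ hw)) hd

lemma prod_linearForm_ne_zero {T : Finset (Fin 3 → ℂ)} (hT : ∀ v ∈ T, IsNormalized v) :
    ∏ v ∈ T, linearForm v ≠ 0 :=
  Finset.prod_ne_zero_iff.2 fun v hv => linearForm_ne_zero (hT v hv).ne_zero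

lemma sum_pderiv_linearForm_mul (v : Fin 3 → ℂ) (g : MvPolynomial (Fin 3) ℂ)
    (w : Fin 3 → MvPolynomial (Fin 3) ℂ) :
    ∑ i, pderiv i (linearForm v * g) * w i =
      linearForm v * ∑ i, pderiv i g * w i + g * ∑ i, C (v i) * w i := by
  simp only [pderiv_mul, pderiv_linearForm, Fin.sum_univ_three]
  ring

/-- A vector field tangent to all lines is tangent to the arrangement. -/
lemma prod_linearForm_dvd_sum_pderiv (T : Finset (Fin 3 → ℂ))
    {w : Fin 3 → MvPolynomial (Fin 3) ℂ} (h : ∀ v ∈ T, linearForm v ∣ ∑ i, C (v i) * w i) :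
    ∏ v ∈ T, linearForm v ∣ ∑ i, pderiv i (∏ v ∈ T, linearForm v) * w i := by
  classical
  induction T using Finset.induction_on with
  | empty => simp
  | insert v T hv ih =>
    rw [Finset.prod_insert hv, sum_pderiv_linearForm_mul]
    refine dvd_add (mul_dvd_mul_left _ (ih fun u hu => h u (Finset.mem_insert_of_mem hu))) ?_
    rw [mul_comm]
    exact mul_dvd_mul_left _ (h v (Finset.mem_insert_self v T))

/-- A vector field that kills the defining polynomial is tangent to all lines. -/
lemma linearForm_dvd_of_sum_pderiv_eq_zero {T : Finset (Fin 3 → ℂ)}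
    (hT : ∀ v ∈ T, IsNormalized v) {w : Fin 3 → MvPolynomial (Fin 3) ℂ}
    (h : ∑ i, pderiv i (∏ v ∈ T, linearForm v) * w i = 0) {v : Fin 3 → ℂ} (hv : v ∈ T) :
    linearForm v ∣ ∑ i, C (v i) * w i := by
  classical
  rw [← Finset.mul_prod_erase T _ hv, sum_pderiv_linearForm_mul] at h
  have : linearForm v ∣ (∏ u ∈ T.erase v, linearForm u) * ∑ i, C (v i) * w i :=
    ⟨-∑ i, pderiv i (∏ u ∈ T.erase v, linearForm u) * w i, by linear_combination h⟩
  refine ((linearForm_prime (hT v hv).ne_zero).dvd_or_dvd this).resolve_left ?_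
  exact linearForm_not_dvd_prod (fun u hu => hT u (Finset.mem_of_mem_erase hu)) (hT v hv)
    (Finset.notMem_erase v T)

/-- Along a line, three tangent fields are confined to a plane, so their determinant vanishes there.
Distinct lines have coprime forms, so the product divides as well. -/
lemma prod_dvd_tripleProduct {T : Finset (Fin 3 → ℂ)} (hT : ∀ v ∈ T, IsNormalized v)
    {u v w : Fin 3 → MvPolynomial (Fin 3) ℂ} (hu : ∀ l ∈ T, linearForm l ∣ ∑ i, C (l i) * u i)
    (hv : ∀ l ∈ T, linearForm l ∣ ∑ i, C (l i) * v i)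
    (hw : ∀ l ∈ T, linearForm l ∣ ∑ i, C (l i) * w i) :
    ∏ l ∈ T, linearForm l ∣ tripleProduct u v w := by
  refine prod_linearForm_dvd hT fun l hl => ?_
  obtain ⟨i, hi⟩ := Function.ne_iff.1 (hT l hl).ne_zero
  have := dvd_smul_tripleProduct (hu l hl) (hv l hl) (hw l hl) i
  have hunit : IsUnit (C (l i) : MvPolynomial (Fin 3) ℂ) :=
    (isUnit_iff_ne_zero.2 hi).map C
  exact (hunit.dvd_mul_left).1 this

lemma isHomogeneous_of_mul {f g : MvPolynomial (Fin 3) ℂ} {d n : ℕ} (hf : f.IsHomogeneous d)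
    (hf0 : f ≠ 0) (h : (g * f).IsHomogeneous (n + d)) : g.IsHomogeneous n := by
  have h1 := DirectSum.coe_decompose_mul_of_right_mem_of_le planeGrading (a := g)
    (show f ∈ planeGrading d from hf) (Nat.le_add_left d n)
  rw [DirectSum.decompose_of_mem_same planeGrading (show g * f ∈ planeGrading (n + d) from h),
    Nat.add_sub_cancel] at h1
  have h2 := mul_right_cancel₀ hf0 h1
  rw [h2]
  exact (DirectSum.decompose planeGrading g n).2

end LinearForms

/-! ### Saito's criterion -/

section Saito

open MvPolynomial LineArrangement

/-- `(p, q)` is a homogeneous vector field of degree `n`, in the affine directions, that is tangent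
to the lines in `T`. -/
structure IsTangent (T : Finset (Fin 3 → ℂ)) (n : ℕ) (p q : MvPolynomial (Fin 3) ℂ) : Prop where
  hom_fst : p.IsHomogeneous n
  hom_snd : q.IsHomogeneous n
  dvd : ∀ v ∈ T, linearForm v ∣ C (v 0) * p + C (v 1) * q

/-- Saito's criterion for the affine lines in `T`. -/
def HasSaitoBasis (T : Finset (Fin 3 → ℂ)) (a b : ℕ) : Prop :=
  ∃ (p₁ q₁ p₂ q₂ : MvPolynomial (Fin 3) ℂ) (c : ℂ), IsTangent T a p₁ q₁ ∧ IsTangent T b p₂ q₂ ∧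
    c ≠ 0 ∧ p₁ * q₂ - p₂ * q₁ = C c * ∏ v ∈ T, linearForm v

lemma linearForm_lineAtInfinity : linearForm lineAtInfinity = X 2 := by
  simp [linearForm, lineAtInfinity, Fin.sum_univ_three]

lemma isNormalized_lineAtInfinity : IsNormalized lineAtInfinity := by
  simp [IsNormalized, lineAtInfinity]

/-- Subtracting a multiple of the Euler field makes a tangent field kill the defining polynomial. -/
lemma IsTangent.exists_euler_correction {T : Finset (Fin 3 → ℂ)} {n d : ℕ}
    {p q f : MvPolynomial (Fin 3) ℂ} (h : IsTangent T n p q) [DecidableEq (Fin 3 → ℂ)]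
    (hf : f = ∏ v ∈ insert lineAtInfinity T, linearForm v) (hfd : f.IsHomogeneous d)
    (hf0 : f ≠ 0) (hd : d ≠ 0) :
    ∃ g : MvPolynomial (Fin 3) ℂ,
      (∀ i, (![p, q, 0] i - g * X i).IsHomogeneous n) ∧
        ∑ i, pderiv i f * (![p, q, 0] i - g * X i) = 0 := by
  have hdvd : f ∣ ∑ i, pderiv i f * ![p, q, 0] i := by
    subst hf
    refine prod_linearForm_dvd_sum_pderiv _ fun v hv => ?_
    rcases Finset.mem_insert.1 hv with rfl | hv
    · simp [lineAtInfinity, Fin.sum_univ_three]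
    · simpa [Fin.sum_univ_three] using h.dvd v hv
  obtain ⟨g, hg⟩ := hdvd
  have hvec : ∀ i, (![p, q, 0] i).IsHomogeneous n := by
    intro i
    fin_cases i
    exacts [h.hom_fst, h.hom_snd, isHomogeneous_zero _ _ _]
  have hdC : C (d : ℂ)⁻¹ * (d : MvPolynomial (Fin 3) ℂ) = 1 := by
    rw [← map_natCast C, ← C_mul, inv_mul_cancel₀ (Nat.cast_ne_zero.2 hd), C_1]
  have hE := hfd.sum_X_mul_pderiv
  -- The field sends `f` to `g * f` and the Euler field sends `f` to `d * f`, hence the factor `1 /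
  -- d`.
  refine ⟨C (d : ℂ)⁻¹ * g, fun i => (hvec i).sub ?_, ?_⟩
  -- Homogeneity is read off after multiplying by `f`. It is proved for `g * X i` and not for `g`,
  -- which avoids the degree `n - 1` when `n = 0`.
  · refine isHomogeneous_of_mul hfd hf0 ?_
    have : C (d : ℂ)⁻¹ * g * X i * f = C (d : ℂ)⁻¹ * X i * ∑ i, pderiv i f * ![p, q, 0] i := by
      rw [hg]; ring
    rw [this]
    have h1 : (∑ i, pderiv i f * ![p, q, 0] i).IsHomogeneous (d - 1 + n) :=
      IsHomogeneous.sum _ _ _ fun i _ => hfd.pderiv.mul (hvec i)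
    have h2 := ((isHomogeneous_C (Fin 3) (d : ℂ)⁻¹).mul (isHomogeneous_X ℂ i)).mul h1
    convert h2 using 1
    omega
  · have : ∑ i, pderiv i f * (![p, q, 0] i - C (d : ℂ)⁻¹ * g * X i) =
        ∑ i, pderiv i f * ![p, q, 0] i - C (d : ℂ)⁻¹ * g * ∑ i, X i * pderiv i f := by
      rw [Finset.mul_sum, ← Finset.sum_sub_distrib]
      exact Finset.sum_congr rfl fun i _ => by ring
    rw [this, hg, hE, nsmul_eq_mul]
    linear_combination - f * g * hdC

/-- Saito's criterion yields a basis of the syzygies of the gradient. -/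
theorem HasSaitoBasis.exists_isSyzygyBasis {T : Finset (Fin 3 → ℂ)} {a b : ℕ}
    [DecidableEq (Fin 3 → ℂ)] (hT : ∀ v ∈ T, IsNormalized v) (hinf : lineAtInfinity ∉ T)
    (h : HasSaitoBasis T a b) :
    ∃ θ₁ θ₂, IsSyzygyBasis planeGrading
      (fun i => pderiv i (∏ v ∈ insert lineAtInfinity T, linearForm v)) a b θ₁ θ₂ := by
  obtain ⟨p₁, q₁, p₂, q₂, c, h₁, h₂, hc, hdet⟩ := h
  set T' := insert lineAtInfinity T with hT'
  have hN : ∀ v ∈ T', IsNormalized v := fun v hv => by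
    rcases Finset.mem_insert.1 hv with rfl | hv
    exacts [isNormalized_lineAtInfinity, hT v hv]
  set f := ∏ v ∈ T', linearForm v with hf
  have hf0 : f ≠ 0 := prod_linearForm_ne_zero hN
  have hfd : f.IsHomogeneous T'.card := by
    simpa using IsHomogeneous.prod T' linearForm (fun _ => 1) fun v _ =>
      linearForm_isHomogeneous v
  have hd : T'.card ≠ 0 := Finset.card_ne_zero_of_mem (Finset.mem_insert_self _ _)
  obtain ⟨g₁, hom₁, sum₁⟩ := h₁.exists_euler_correction hf hfd hf0 hd
  obtain ⟨g₂, hom₂, sum₂⟩ := h₂.exists_euler_correction hf hfd hf0 hd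
  set θ₁ : Fin 3 → MvPolynomial (Fin 3) ℂ := fun i => ![p₁, q₁, 0] i - g₁ * X i with hθ₁
  set θ₂ : Fin 3 → MvPolynomial (Fin 3) ℂ := fun i => ![p₂, q₂, 0] i - g₂ * X i with hθ₂
  have hE : ∑ i, pderiv i f * X i = C (T'.card : ℂ) * f := by
    have := hfd.sum_X_mul_pderiv
    rw [nsmul_eq_mul] at this
    rw [map_natCast, ← this]
    exact Finset.sum_congr rfl fun i _ => mul_comm _ _
  -- The Euler corrections do not change a determinant whose first column is the Euler field;
  -- expanding along the last row leaves `X 2` times the affine determinant.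
  have htri : tripleProduct (fun i => X i) θ₁ θ₂ = C c * f := by
    rw [hf, hT', Finset.prod_insert hinf, linearForm_lineAtInfinity]
    simp only [tripleProduct, hθ₁, hθ₂, Matrix.cons_val]
    linear_combination X 2 * hdet
  have hd' : (C (T'.card : ℂ) : MvPolynomial (Fin 3) ℂ) ≠ 0 := by
    simpa [C_eq_zero] using hd
  have hc' : (C c : MvPolynomial (Fin 3) ℂ) ≠ 0 := by simpa [C_eq_zero] using hc
  have hEdvd : ∀ l ∈ T', linearForm l ∣ ∑ i, C (l i) * (X i : MvPolynomial (Fin 3) ℂ) :=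
    fun l _ => dvd_rfl
  refine ⟨θ₁, θ₂, hom₁, hom₂, sum₁, sum₂, ?_, fun w hw => ?_⟩
  · obtain ⟨x0, x1, x2⟩ := cross_eq sum₁ sum₂ hE hf0 htri
    -- If all minors vanished, so would `c` times the gradient of `f`, and then `f` itself by
    -- Euler's relation.
    by_contra! hall
    have hz : C c * (C (T'.card : ℂ) * f) = 0 := by
      rw [← hE, Fin.sum_univ_three]
      linear_combination -X 0 * x0 - X 1 * x1 - X 2 * x2 +
        C (T'.card : ℂ) * (X 0 * hall 1 2 + X 1 * hall 2 0 + X 2 * hall 0 1)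
    exact mul_ne_zero hc' (mul_ne_zero hd' hf0) hz
  · have htan : ∀ {u : Fin 3 → MvPolynomial (Fin 3) ℂ}, ∑ i, pderiv i f * u i = 0 →
        ∀ l ∈ T', linearForm l ∣ ∑ i, C (l i) * u i := fun hu l hl =>
      linearForm_dvd_of_sum_pderiv_eq_zero hN hu hl
    -- Every syzygy is tangent to all lines, so `f` divides the Cramer determinants; the quotients,
    -- up to `c`, are the required coefficients.
    obtain ⟨t₁, ht₁⟩ := prod_dvd_tripleProduct hN hEdvd (htan hw) (htan sum₂)
    obtain ⟨t₂, ht₂⟩ := prod_dvd_tripleProduct hN hEdvd (htan sum₁) (htan hw)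
    have hcc : C c⁻¹ * C c = (1 : MvPolynomial (Fin 3) ℂ) := by
      rw [← C_mul, inv_mul_cancel₀ hc, C_1]
    refine ⟨C c⁻¹ * t₁, C c⁻¹ * t₂, fun i => ?_⟩
    have := smul_eq_of_orthogonal sum₁ sum₂ hE hf0 hd' htri hw ht₁ ht₂ i
    linear_combination C c⁻¹ * this - w i * hcc

end Saito

/-! ### Restriction of polynomials to a line -/

section RestrictToLine

open MvPolynomial LineArrangement

lemma eval_smul_of_isHomogeneous {F : MvPolynomial (Fin 3) ℂ} {n : ℕ} (hF : F.IsHomogeneous n)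
    (c : ℂ) (x : Fin 3 → ℂ) : eval (c • x) F = c ^ n * eval x F := by
  rw [eval_eq', eval_eq', Finset.mul_sum]
  refine Finset.sum_congr rfl fun m hm => ?_
  have hmn : ∑ i, m i = n := by
    rw [← hF (mem_support_iff.1 hm), Finsupp.weight_apply, Finsupp.sum_fintype _ _ (by simp)]
    simp
  simp only [Pi.smul_apply, smul_eq_mul, mul_pow, Finset.prod_mul_distrib,
    Finset.prod_pow_eq_pow_sum, hmn]
  ring

/-- Restriction of polynomials to the line `x + v₁ y + v₂ z = 0`, in the chart `z = 1` with
coordinate `y`. -/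
noncomputable def restrict (v : Fin 3 → ℂ) : MvPolynomial (Fin 3) ℂ →ₐ[ℂ] Polynomial ℂ :=
  aeval ![-(Polynomial.C (v 2) + Polynomial.C (v 1) * Polynomial.X), Polynomial.X, 1]

variable {v : Fin 3 → ℂ}

lemma restrict_C (v : Fin 3 → ℂ) (c : ℂ) : restrict v (C c) = Polynomial.C c := by
  simp [restrict]

lemma restrict_linearForm (v w : Fin 3 → ℂ) :
    restrict v (linearForm w) = Polynomial.C (w 1 - w 0 * v 1) * Polynomial.X +
      Polynomial.C (w 2 - w 0 * v 2) := by
  simp [restrict, linearForm, Fin.sum_univ_three]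
  ring

lemma restrict_self (hv : v 0 = 1) : restrict v (linearForm v) = 0 := by
  simp [restrict_linearForm, hv]

lemma eval_restrict (v : Fin 3 → ℂ) (F : MvPolynomial (Fin 3) ℂ) (s : ℂ) :
    (restrict v F).eval s = eval ![-(v 2 + v 1 * s), s, 1] F := by
  induction F using MvPolynomial.induction_on with
  | C c => simp
  | add p q hp hq => simp [hp, hq]
  | mul_X p i hp =>
    rw [map_mul, Polynomial.eval_mul, hp, map_mul]
    congr 1
    fin_cases i <;> simp [restrict]

lemma natDegree_restrict_le (v : Fin 3 → ℂ) (F : MvPolynomial (Fin 3) ℂ) :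
    (restrict v F).natDegree ≤ F.totalDegree := by
  have := MvPolynomial.aeval_natDegree_le (m := F.totalDegree) (n := 1) F le_rfl
    (![-(Polynomial.C (v 2) + Polynomial.C (v 1) * Polynomial.X), Polynomial.X, 1] :
      Fin 3 → Polynomial ℂ) (fun i => by
        fin_cases i
        · simp only [Fin.zero_eta, Matrix.cons_val_zero, Polynomial.natDegree_neg]
          compute_degree
        · simp
        · simp)
  simpa [restrict] using this

/-- The restriction sees only the chart `z = 1`, but homogeneity spreads the vanishing to all points
of the line with `z ≠ 0`, which are dense. Eliminating the first variable then gives divisibility.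
-/
lemma linearForm_dvd_of_restrict_eq_zero (hv : v 0 = 1) {F : MvPolynomial (Fin 3) ℂ} {n : ℕ}
    (hF : F.IsHomogeneous n) (h : restrict v F = 0) : linearForm v ∣ F := by
  let ρ : MvPolynomial (Fin 3) ℂ →ₐ[ℂ] MvPolynomial (Fin 3) ℂ :=
    aeval ![-(C (v 1) * X 1 + C (v 2) * X 2), X 1, X 2]
  have hρ : ρ F = 0 := by
    have hX : (X 2 : MvPolynomial (Fin 3) ℂ) ≠ 0 := X_ne_zero 2
    -- The factor `X 2` takes care of the points with `z = 0`, where rescaling into the chart is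
    -- impossible.
    refine (mul_eq_zero.1 (?_ : X 2 * ρ F = 0)).resolve_left hX
    refine MvPolynomial.funext fun x => ?_
    rw [map_mul, map_zero, eval_X, mul_eq_zero, or_iff_not_imp_left]
    intro hx
    have h1 : eval x (ρ F) = eval ![-(v 1 * x 1 + v 2 * x 2), x 1, x 2] F := by
      rw [← aeval_eq_eval, ← aeval_eq_eval, ← AlgHom.comp_apply]
      congr 1
      ext i
      fin_cases i <;> simp [ρ]
    have h2 : (![-(v 1 * x 1 + v 2 * x 2), x 1, x 2] : Fin 3 → ℂ) =
        x 2 • ![-(v 2 + v 1 * (x 1 / x 2)), x 1 / x 2, 1] := by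
      funext i
      fin_cases i
      · simp; field_simp; ring
      · simp; field_simp
      · simp
    rw [h1, h2, eval_smul_of_isHomogeneous hF, ← eval_restrict, h, Polynomial.eval_zero, mul_zero]
  -- The substitution `ρ` is the identity modulo the linear form.
  have hq : (Ideal.Quotient.mkₐ ℂ (Ideal.span {linearForm v})).comp ρ =
      Ideal.Quotient.mkₐ ℂ (Ideal.span {linearForm v}) := by
    ext i
    simp only [AlgHom.comp_apply, Ideal.Quotient.mkₐ_eq_mk, Ideal.Quotient.mk_eq_mk_iff_sub_mem,
      Ideal.mem_span_singleton]
    fin_cases i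
    · refine ⟨-1, ?_⟩
      simp [ρ, linearForm, Fin.sum_univ_three, hv]
      ring
    · simp [ρ]
    · simp [ρ]
  have := congr($hq F)
  rw [AlgHom.comp_apply, hρ, map_zero] at this
  exact Ideal.mem_span_singleton.1 (Ideal.Quotient.eq_zero_iff_mem.1 this.symm)

lemma exists_restrict_eq (v : Fin 3 → ℂ) {g : Polynomial ℂ} {n : ℕ} (hg : g.natDegree ≤ n) :
    ∃ G : MvPolynomial (Fin 3) ℂ, G.IsHomogeneous n ∧ restrict v G = g := by
  refine ⟨∑ i ∈ Finset.range (n + 1), C (g.coeff i) * (X 1 ^ i * X 2 ^ (n - i)), ?_, ?_⟩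
  · refine IsHomogeneous.sum _ _ _ fun i hi => ?_
    have hi' : i ≤ n := Nat.lt_succ_iff.1 (Finset.mem_range.1 hi)
    have := (isHomogeneous_C (Fin 3) (g.coeff i)).mul
      (((isHomogeneous_X ℂ (1 : Fin 3)).pow i).mul ((isHomogeneous_X ℂ (2 : Fin 3)).pow (n - i)))
    convert this using 1
    omega
  · conv_rhs => rw [g.as_sum_range_C_mul_X_pow' (Nat.lt_succ_of_le hg)]
    rw [map_sum]
    refine Finset.sum_congr rfl fun i _ => ?_
    simp only [map_mul, map_pow, restrict_C]
    simp [restrict]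

end RestrictToLine

/-! ### The normal component of a tangent field along a new line -/

section Addition

open MvPolynomial LineArrangement

/-- The coordinate, on the line `v`, of the intersection with the line `w`. -/
noncomputable def crossing (v w : Fin 3 → ℂ) : ℂ := -(w 2 - w 0 * v 2) / (w 1 - w 0 * v 1)

open Classical in
/-- The lines that meet `v` in the affine chart. -/
noncomputable def transversals (v : Fin 3 → ℂ) (T : Finset (Fin 3 → ℂ)) : Finset (Fin 3 → ℂ) :=
  T.filter fun w => w 1 - w 0 * v 1 ≠ 0

open Classical in
/-- The points of `v` on the other lines. -/
noncomputable def crossings (v : Fin 3 → ℂ) (T : Finset (Fin 3 → ℂ)) : Finset ℂ :=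
  (transversals v T).image (crossing v)

variable {v : Fin 3 → ℂ} {T : Finset (Fin 3 → ℂ)} {n : ℕ} {p q : MvPolynomial (Fin 3) ℂ}

lemma mem_transversals {w : Fin 3 → ℂ} :
    w ∈ transversals v T ↔ w ∈ T ∧ w 1 - w 0 * v 1 ≠ 0 := by
  simp [transversals]

lemma restrict_linearForm_of_transversal {w : Fin 3 → ℂ} (hw : w 1 - w 0 * v 1 ≠ 0) :
    restrict v (linearForm w) =
      Polynomial.C (w 1 - w 0 * v 1) * (Polynomial.X - Polynomial.C (crossing v w)) := by
  rw [restrict_linearForm, mul_sub, ← Polynomial.C_mul, crossing, mul_div_cancel₀ _ hw,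
    Polynomial.C_neg, sub_neg_eq_add]

open Classical in
/-- The other lines through a point of `v`. -/
noncomputable def pencil (v : Fin 3 → ℂ) (T : Finset (Fin 3 → ℂ)) (r : ℂ) :
    Finset (Fin 3 → ℂ) :=
  (transversals v T).filter fun w => crossing v w = r

lemma mem_pencil {w : Fin 3 → ℂ} {r : ℂ} :
    w ∈ pencil v T r ↔ (w ∈ T ∧ w 1 - w 0 * v 1 ≠ 0) ∧ crossing v w = r := by
  simp [pencil, mem_transversals]

/-- Fix one line `w` of the pencil, with `θ(w) = w * g`. For any other line `w'` of the pencil, `w'`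
is a combination of `w` and `v`, so tangency to both makes `w'` divide `θ(v) - v * g`. Restricting
to `v` kills `v * g` and turns each `w'` into a multiple of `X - r`. One line of the pencil is
spent, hence the exponent. -/
lemma pow_dvd_restrict (hT : ∀ w ∈ T, IsNormalized w) (hv : v 0 = 1)
    (h : IsTangent T n p q) (r : ℂ) :
    (Polynomial.X - Polynomial.C r) ^ ((pencil v T r).card - 1) ∣
      restrict v (p + C (v 1) * q) := by
  classical
  rcases (pencil v T r).eq_empty_or_nonempty with he | ⟨w, hw⟩
  · simp [he]
  obtain ⟨⟨hwT, hw1⟩, hwr⟩ := mem_pencil.1 hw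
  obtain ⟨g, hg⟩ := h.dvd w hwT
  have hdvd : ∏ w' ∈ (pencil v T r).erase w, linearForm w' ∣
      p + C (v 1) * q - linearForm v * g := by
    refine prod_linearForm_dvd (fun w' hw' => hT w' (mem_pencil.1 (Finset.mem_of_mem_erase hw')).1.1)
      fun w' hw' => ?_
    obtain ⟨hne, hw'⟩ := Finset.mem_erase.1 hw'
    obtain ⟨⟨hwT', hw1'⟩, hwr'⟩ := mem_pencil.1 hw'
    obtain ⟨g', hg'⟩ := h.dvd w' hwT'
    -- The three lines are concurrent: `w' = l * w + m * v`. Here `l` is found by comparing slopes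
    -- along `v`, and `m` then follows from `v 0 = 1`.
    set l : ℂ := (w' 1 - w' 0 * v 1) / (w 1 - w 0 * v 1) with hl
    set m : ℂ := w' 0 - l * w 0 with hm
    have e0 : w' 0 = l * w 0 + m * v 0 := by rw [hm, hv]; ring
    have e1 : w' 1 = l * w 1 + m * v 1 := by
      have : l * (w 1 - w 0 * v 1) = w' 1 - w' 0 * v 1 := div_mul_cancel₀ _ hw1
      rw [hm]; linear_combination -this
    have e2 : w' 2 = l * w 2 + m * v 2 := by
      have h1 : w 2 - w 0 * v 2 = -r * (w 1 - w 0 * v 1) := by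
        rw [← hwr, crossing]; field_simp
      have h2 : w' 2 - w' 0 * v 2 = -r * (w' 1 - w' 0 * v 1) := by
        rw [← hwr', crossing]; field_simp
      have h3 : l * (w 1 - w 0 * v 1) = w' 1 - w' 0 * v 1 := div_mul_cancel₀ _ hw1
      rw [hm]; linear_combination h2 - l * h1 + r * h3
    have hm0 : m ≠ 0 := by
      intro hm0
      refine hne ((hT w hwT).eq_of_smul (hT w' hwT') l (funext fun i => ?_))
      fin_cases i
      · simpa [hm0] using e0
      · simpa [hm0] using e1
      · simpa [hm0] using e2
    have hlin : linearForm w' = C l * linearForm w + C m * linearForm v := by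
      simp only [linearForm, Fin.sum_univ_three, e0, e1, e2, map_add, map_mul]
      ring
    have hC : C m⁻¹ * C m = (1 : MvPolynomial (Fin 3) ℂ) := by
      rw [← C_mul, inv_mul_cancel₀ hm0, C_1]
    refine ⟨C m⁻¹ * (g' - g), ?_⟩
    rw [e0, e1, hv] at hg'
    simp only [map_add, map_mul, mul_one] at hg'
    linear_combination C m⁻¹ * hg' - C m⁻¹ * C l * hg + C m⁻¹ * g * hlin -
      (p + C (v 1) * q - linearForm v * g) * hC
  have h1 := map_dvd (restrict v) hdvd
  rw [map_sub, map_mul, restrict_self hv, zero_mul, sub_zero, map_prod] at h1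
  refine dvd_trans ?_ h1
  rw [← Finset.card_erase_of_mem hw, ← Finset.prod_const]
  refine Finset.prod_dvd_prod_of_dvd _ _ fun w' hw' => ?_
  obtain ⟨⟨-, hw1'⟩, hwr'⟩ := mem_pencil.1 (Finset.mem_of_mem_erase hw')
  rw [restrict_linearForm_of_transversal hw1', hwr']
  exact dvd_mul_left _ _

/-- The polynomial on `v` that divides the normal component of every tangent field. -/
noncomputable def multiplicityPolynomial (v : Fin 3 → ℂ) (T : Finset (Fin 3 → ℂ)) :
    Polynomial ℂ :=
  ∏ r ∈ crossings v T, (Polynomial.X - Polynomial.C r) ^ ((pencil v T r).card - 1)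

lemma multiplicityPolynomial_monic : (multiplicityPolynomial v T).Monic :=
  Polynomial.monic_prod_of_monic _ _ fun r _ => (Polynomial.monic_X_sub_C r).pow _

/-- The transversals are partitioned by their crossing, and each crossing contributes one less than
the number of transversals through it. -/
lemma natDegree_multiplicityPolynomial :
    (multiplicityPolynomial v T).natDegree + (crossings v T).card = (transversals v T).card := by
  classical
  rw [multiplicityPolynomial, Polynomial.natDegree_prod_of_monic _ _
    fun r _ => (Polynomial.monic_X_sub_C r).pow _, Finset.card_eq_sum_ones, ← Finset.sum_add_distrib,
    Finset.card_eq_sum_card_image (crossing v) (transversals v T)]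
  refine Finset.sum_congr (by rw [crossings]) fun r hr => ?_
  rw [Polynomial.natDegree_pow, Polynomial.natDegree_X_sub_C, mul_one]
  have hpos : 0 < (pencil v T r).card := by
    obtain ⟨w, hw, hwr⟩ := Finset.mem_image.1 (show r ∈ (transversals v T).image (crossing v) from hr)
    exact Finset.card_pos.2 ⟨w, mem_pencil.2 ⟨mem_transversals.1 hw, hwr⟩⟩
  rw [Nat.sub_add_cancel hpos]
  rfl

lemma multiplicityPolynomial_dvd (hT : ∀ w ∈ T, IsNormalized w) (hv : v 0 = 1)
    (h : IsTangent T n p q) :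
    multiplicityPolynomial v T ∣ restrict v (p + C (v 1) * q) := by
  refine Finset.prod_dvd_of_coprime (fun r _ s _ hrs => ?_) fun r _ => pow_dvd_restrict hT hv h r
  exact (Polynomial.isCoprime_X_sub_C_of_isUnit_sub
    (isUnit_iff_ne_zero.2 (sub_ne_zero.2 hrs))).pow

lemma IsTangent.normal_isHomogeneous (h : IsTangent T n p q) (c : ℂ) :
    (p + C c * q).IsHomogeneous n := by
  have := (isHomogeneous_C (Fin 3) c).mul h.hom_snd
  rw [zero_add] at this
  exact h.hom_fst.add this

/-- Lines parallel to `v` lower the degree of the normal component. -/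
lemma natDegree_restrict_add_le (hT : ∀ w ∈ T, IsNormalized w) (hinf : lineAtInfinity ∉ T)
    (h : IsTangent T n p q) (hne : restrict v (p + C (v 1) * q) ≠ 0) :
    (restrict v (p + C (v 1) * q)).natDegree + T.card ≤ n + (transversals v T).card := by
  classical
  set P := T.filter fun w => ¬ (w 1 - w 0 * v 1 ≠ 0) with hP
  have hcard : (transversals v T).card + P.card = T.card :=
    Finset.card_filter_add_card_filter_not _
  have hPT : ∀ w ∈ P, w ∈ T ∧ w 1 = w 0 * v 1 := fun w hw => by
    rw [hP, Finset.mem_filter, not_not, sub_eq_zero] at hw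
    exact hw
  -- For a line parallel to `v` the tangency condition concerns the same normal component up to a
  -- scalar, so its form divides that component before restriction, and it restricts to a constant.
  have hdvd : ∏ w ∈ P, linearForm w ∣ p + C (v 1) * q := by
    refine prod_linearForm_dvd (fun w hw => hT w (hPT w hw).1) fun w hw => ?_
    obtain ⟨hwT, hw1⟩ := hPT w hw
    -- A vanishing first coefficient would make `w` the line at infinity.
    have hw0 : w 0 ≠ 0 := by
      intro hw0
      rw [hw0, zero_mul] at hw1
      refine hinf ?_
      convert hwT
      have hn := hT w hwT
      simp only [IsNormalized, hw0, hw1, zero_ne_one, false_or, and_false, true_and] at hn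
      funext i
      fin_cases i
      · exact hw0.symm
      · exact hw1.symm
      · exact hn.symm
    have hd := h.dvd w hwT
    rw [hw1, C_mul, mul_assoc, ← mul_add] at hd
    exact ((isUnit_iff_ne_zero.2 hw0).map C).dvd_mul_left.1 hd
  obtain ⟨g, hg⟩ := hdvd
  have hu : p + C (v 1) * q ≠ 0 := fun hu => hne (by rw [hu, map_zero])
  have hprod : ∏ w ∈ P, linearForm w ≠ 0 := fun h0 => hu (by rw [hg, h0, zero_mul])
  have hg0 : g ≠ 0 := fun h0 => hu (by rw [hg, h0, mul_zero])
  have hdeg := (h.normal_isHomogeneous (v 1)).totalDegree hu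
  rw [hg, totalDegree_mul_of_isDomain hprod hg0] at hdeg
  have hPdeg : (∏ w ∈ P, linearForm w).totalDegree = P.card := by
    have : (∏ w ∈ P, linearForm w).IsHomogeneous P.card := by
      simpa using IsHomogeneous.prod P linearForm (fun _ => 1) fun v _ =>
        linearForm_isHomogeneous v
    exact this.totalDegree hprod
  have hconst : (restrict v (∏ w ∈ P, linearForm w)).natDegree = 0 := by
    rw [map_prod]
    refine Nat.le_zero.1 ((Polynomial.natDegree_prod_le _ _).trans (le_of_eq ?_))
    refine Finset.sum_eq_zero fun w hw => ?_
    rw [restrict_linearForm, (hPT w hw).2, sub_self, Polynomial.C_0, zero_mul, zero_add,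
      Polynomial.natDegree_C]
  have hle : (restrict v (p + C (v 1) * q)).natDegree ≤ g.totalDegree := by
    rw [hg, map_mul]
    refine Polynomial.natDegree_mul_le.trans ?_
    rw [hconst, zero_add]
    exact natDegree_restrict_le v g
  omega

lemma IsTangent.insert [DecidableEq (Fin 3 → ℂ)] (h : IsTangent T n p q)
    (hd : linearForm v ∣ C (v 0) * p + C (v 1) * q) : IsTangent (insert v T) n p q :=
  ⟨h.hom_fst, h.hom_snd, fun w hw => by
    rcases Finset.mem_insert.1 hw with rfl | hw
    exacts [hd, h.dvd w hw]⟩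

lemma IsTangent.linearForm_mul [DecidableEq (Fin 3 → ℂ)] (h : IsTangent T n p q)
    (v : Fin 3 → ℂ) :
    IsTangent (Insert.insert v T) (n + 1) (linearForm v * p) (linearForm v * q) := by
  have hh : ∀ {g : MvPolynomial (Fin 3) ℂ}, g.IsHomogeneous n →
      (linearForm v * g).IsHomogeneous (n + 1) := fun hg => by
    rw [add_comm]; exact (linearForm_isHomogeneous v).mul hg
  have e : ∀ w : Fin 3 → ℂ, C (w 0) * (linearForm v * p) + C (w 1) * (linearForm v * q) =
      linearForm v * (C (w 0) * p + C (w 1) * q) := fun w => by ring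
  refine ⟨hh h.hom_fst, hh h.hom_snd, fun w hw => ?_⟩
  rw [e]
  rcases Finset.mem_insert.1 hw with rfl | hw
  exacts [dvd_mul_right _ _, (h.dvd w hw).mul_left _]

lemma IsTangent.sub_mul {m : ℕ} {p' q' G : MvPolynomial (Fin 3) ℂ} (h : IsTangent T n p q)
    (h' : IsTangent T m p' q') (hG : G = 0 ∨ m ≤ n ∧ G.IsHomogeneous (n - m)) :
    IsTangent T n (p - G * p') (q - G * q') := by
  have hh : ∀ {g : MvPolynomial (Fin 3) ℂ}, g.IsHomogeneous m → (G * g).IsHomogeneous n := by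
    intro g hg
    rcases hG with rfl | ⟨hmn, hG⟩
    · rw [zero_mul]; exact isHomogeneous_zero _ _ _
    · have := hG.mul hg
      rwa [Nat.sub_add_cancel hmn] at this
  refine ⟨h.hom_fst.sub (hh h'.hom_fst), h.hom_snd.sub (hh h'.hom_snd), fun w hw => ?_⟩
  have : C (w 0) * (p - G * p') + C (w 1) * (q - G * q') =
      (C (w 0) * p + C (w 1) * q) - G * (C (w 0) * p' + C (w 1) * q') := by ring
  rw [this]
  exact dvd_sub (h.dvd w hw) ((h'.dvd w hw).mul_left _)

/-- The components of a tangent field vanish at every crossing on `v` if the field is tangent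
to `v`. -/
lemma IsTangent.eval_restrict_eq_zero (h : IsTangent T n p q)
    (hu : restrict v (p + C (v 1) * q) = 0) {r : ℂ} (hr : r ∈ crossings v T) :
    (restrict v p).eval r = 0 ∧ (restrict v q).eval r = 0 := by
  classical
  obtain ⟨w, hw, hwr⟩ := Finset.mem_image.1 (show r ∈ (transversals v T).image (crossing v) from hr)
  obtain ⟨hwT, hw1⟩ := mem_transversals.1 hw
  have h1 := map_dvd (restrict v) (h.dvd w hwT)
  rw [restrict_linearForm_of_transversal hw1, hwr] at h1
  have h2 : (restrict v (C (w 0) * p + C (w 1) * q)).eval r = 0 :=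
    Polynomial.dvd_iff_isRoot.1 ((dvd_mul_left _ _).trans h1)
  have h3 := congr(Polynomial.eval r $hu)
  simp only [map_add, map_mul, restrict_C, Polynomial.eval_add, Polynomial.eval_mul,
    Polynomial.eval_C, Polynomial.eval_zero] at h2 h3
  have hq : (restrict v q).eval r = 0 := by
    refine mul_left_cancel₀ hw1 ?_
    linear_combination h2 - w 0 * h3
  exact ⟨by rw [hq, mul_zero, add_zero] at h3; exact h3, hq⟩

end Addition

/-! ### The addition theorem -/

section AdditionTheorem

open MvPolynomial LineArrangement

variable {v : Fin 3 → ℂ} {T : Finset (Fin 3 → ℂ)} {a b : ℕ}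

lemma HasSaitoBasis.card_eq (hT : ∀ w ∈ T, IsNormalized w) (h : HasSaitoBasis T a b) :
    T.card = a + b := by
  obtain ⟨p₁, q₁, p₂, q₂, c, h₁, h₂, hc, hdet⟩ := h
  have e1 : (p₁ * q₂ - p₂ * q₁).IsHomogeneous (a + b) :=
    (h₁.hom_fst.mul h₂.hom_snd).sub (by rw [add_comm]; exact h₂.hom_fst.mul h₁.hom_snd)
  have e2 : (C c * ∏ w ∈ T, linearForm w).IsHomogeneous (0 + T.card) :=
    (isHomogeneous_C _ c).mul (by
      simpa using IsHomogeneous.prod T linearForm (fun _ => 1) fun v _ =>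
        linearForm_isHomogeneous v)
  rw [hdet] at e1
  have hne : C c * ∏ w ∈ T, linearForm w ≠ 0 :=
    mul_ne_zero (by simpa [C_eq_zero] using hc) (prod_linearForm_ne_zero hT)
  simpa using e2.inj_right e1 hne

/-- The normal component of a tangent field of degree `n` is a multiple of the multiplicity
polynomial, with a cofactor of controlled degree. -/
lemma IsTangent.exists_cofactor {n : ℕ} {p q : MvPolynomial (Fin 3) ℂ}
    (hT : ∀ w ∈ T, IsNormalized w) (hinf : lineAtInfinity ∉ T) (hv : v 0 = 1)
    (hcard : T.card = a + (crossings v T).card) (h : IsTangent T n p q) :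
    ∃ g : Polynomial ℂ, restrict v (p + C (v 1) * q) = multiplicityPolynomial v T * g ∧
      (g = 0 ∨ g.natDegree + a ≤ n) := by
  obtain ⟨g, hg⟩ := multiplicityPolynomial_dvd hT hv h
  refine ⟨g, hg, or_iff_not_imp_left.2 fun hg0 => ?_⟩
  have hne : restrict v (p + C (v 1) * q) ≠ 0 := by
    rw [hg]; exact mul_ne_zero multiplicityPolynomial_monic.ne_zero hg0
  -- Parallel lines and multiple crossings together use up `T.card` minus the number of crossings,
  -- which is `a`; only degree `n - a` is left for the cofactor.
  have h1 := natDegree_restrict_add_le hT hinf h hne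
  rw [hg, Polynomial.natDegree_mul multiplicityPolynomial_monic.ne_zero hg0] at h1
  have h2 := natDegree_multiplicityPolynomial (v := v) (T := T)
  omega

/-- A nonzero constant cofactor lets the first field cancel the normal component of the second along
`v`. The corrected second field is tangent to `v`, and the first becomes so after multiplication by
the form of `v`; the determinant gains exactly that form. -/
lemma exists_of_cofactor_eq_C [DecidableEq (Fin 3 → ℂ)] (hvT : v ∉ T) (hv : v 0 = 1)
    {m n : ℕ} {p₁ q₁ p₂ q₂ : MvPolynomial (Fin 3) ℂ} {c e : ℂ} {g : Polynomial ℂ}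
    (h₁ : IsTangent T m p₁ q₁) (h₂ : IsTangent T n p₂ q₂) (hc : c ≠ 0)
    (hdet : p₁ * q₂ - p₂ * q₁ = C c * ∏ w ∈ T, linearForm w) (he : e ≠ 0)
    (hu₁ : restrict v (p₁ + C (v 1) * q₁) = multiplicityPolynomial v T * Polynomial.C e)
    (hu₂ : restrict v (p₂ + C (v 1) * q₂) = multiplicityPolynomial v T * g)
    (hg : g = 0 ∨ g.natDegree + m ≤ n) : HasSaitoBasis (insert v T) (m + 1) n := by
  -- The alternative `G = 0` is needed because `m ≤ n` is not known when `g = 0`.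
  obtain ⟨G, hG, hGr⟩ : ∃ G : MvPolynomial (Fin 3) ℂ,
      (G = 0 ∨ m ≤ n ∧ G.IsHomogeneous (n - m)) ∧ restrict v G = Polynomial.C e⁻¹ * g := by
    rcases hg with rfl | hg
    · exact ⟨0, Or.inl rfl, by simp⟩
    · obtain ⟨G, h1, h2⟩ := exists_restrict_eq v (n := n - m)
        (g := Polynomial.C e⁻¹ * g) ((Polynomial.natDegree_C_mul_le _ _).trans (by omega))
      exact ⟨G, Or.inr ⟨by omega, h1⟩, h2⟩
  have h₃ := h₂.sub_mul h₁ hG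
  refine ⟨linearForm v * p₁, linearForm v * q₁, p₂ - G * p₁, q₂ - G * q₁, c,
    h₁.linearForm_mul v, h₃.insert ?_, hc, ?_⟩
  · rw [hv, C_1, one_mul]
    refine linearForm_dvd_of_restrict_eq_zero hv (h₃.normal_isHomogeneous (v 1)) ?_
    have : p₂ - G * p₁ + C (v 1) * (q₂ - G * q₁) =
        (p₂ + C (v 1) * q₂) - G * (p₁ + C (v 1) * q₁) := by ring
    rw [this, map_sub, map_mul, hu₁, hu₂, hGr]
    have hC : Polynomial.C e⁻¹ * Polynomial.C e = 1 := by
      rw [← Polynomial.C_mul, inv_mul_cancel₀ he, Polynomial.C_1]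
    linear_combination -(multiplicityPolynomial v T * g) * hC
  · rw [Finset.prod_insert hvT]
    linear_combination linearForm v * hdet

lemma HasSaitoBasis.symm (h : HasSaitoBasis T a b) : HasSaitoBasis T b a := by
  obtain ⟨p₁, q₁, p₂, q₂, c, h₁, h₂, hc, hdet⟩ := h
  exact ⟨p₂, q₂, p₁, q₁, -c, h₂, h₁, neg_ne_zero.2 hc, by
    rw [C_neg]; linear_combination -hdet⟩

/-- The addition theorem: adding a line that meets the arrangement in `b` affine points raises
the exponent `a`. -/
theorem HasSaitoBasis.addition [DecidableEq (Fin 3 → ℂ)] (hT : ∀ w ∈ T, IsNormalized w)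
    (hinf : lineAtInfinity ∉ T) (hv : v 0 = 1) (hvT : v ∉ T) (h : HasSaitoBasis T a b)
    (hcross : (crossings v T).card = b) : HasSaitoBasis (insert v T) (a + 1) b := by
  have hcard : T.card = a + (crossings v T).card := by rw [hcross, h.card_eq hT]
  obtain ⟨p₁, q₁, p₂, q₂, c, h₁, h₂, hc, hdet⟩ := h
  obtain ⟨g₁, hg₁, hd₁⟩ := h₁.exists_cofactor hT hinf hv hcard
  obtain ⟨g₂, hg₂, hd₂⟩ := h₂.exists_cofactor hT hinf hv hcard
  have hnv : IsNormalized v := Or.inl hv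
  -- The determinant is a constant times the product of the old forms, and `v` is not among them.
  have hndvd : ¬ linearForm v ∣ p₁ * q₂ - p₂ * q₁ := fun hd => by
    rw [hdet] at hd
    exact linearForm_not_dvd_prod hT hnv hvT
      (((isUnit_iff_ne_zero.2 hc).map C).dvd_mul_left.1 hd)
  by_cases hg₁0 : g₁ = 0
  -- If both fields were tangent to `v`, their determinant would vanish on it.
  · have hg₂0 : g₂ ≠ 0 := by
      rintro rfl
      rw [hg₁0, mul_zero] at hg₁
      rw [mul_zero] at hg₂
      have d1 := linearForm_dvd_of_restrict_eq_zero hv (h₁.normal_isHomogeneous (v 1)) hg₁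
      have d2 := linearForm_dvd_of_restrict_eq_zero hv (h₂.normal_isHomogeneous (v 1)) hg₂
      refine hndvd ?_
      have : p₁ * q₂ - p₂ * q₁ =
          (p₁ + C (v 1) * q₁) * q₂ - (p₂ + C (v 1) * q₂) * q₁ := by ring
      rw [this]
      exact dvd_sub (d1.mul_right _) (d2.mul_right _)
    have hd := hd₂.resolve_left hg₂0
    rw [hg₁0, mul_zero] at hg₁
    -- For equal degrees the cofactor of the second field is also constant, and the two fields
    -- exchange roles.
    rcases (show a ≤ b by omega).eq_or_lt with rfl | hab
    · obtain ⟨e, rfl⟩ : ∃ e, g₂ = Polynomial.C e :=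
        ⟨_, Polynomial.eq_C_of_natDegree_eq_zero (by omega)⟩
      exact exists_of_cofactor_eq_C hvT hv h₂ h₁ (neg_ne_zero.2 hc)
        (by rw [C_neg]; linear_combination -hdet) (by simpa using hg₂0) hg₂
        (by rw [hg₁, mul_zero]) (Or.inl rfl)
    -- The first field is now tangent to `v` and so vanishes at all `b` crossings. Its degree `a` is
    -- smaller than `b`, so it vanishes along `v`, and with it the determinant.
    · exfalso
      have hz : ∀ {F : MvPolynomial (Fin 3) ℂ}, F.IsHomogeneous a →
          (∀ r ∈ crossings v T, (restrict v F).eval r = 0) → linearForm v ∣ F := by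
        intro F hF hr
        refine linearForm_dvd_of_restrict_eq_zero hv hF
          (Polynomial.eq_zero_of_natDegree_lt_card_of_eval_eq_zero' _ (crossings v T) hr ?_)
        exact ((natDegree_restrict_le v F).trans hF.totalDegree_le).trans_lt (by rwa [hcross])
      have d1 := hz h₁.hom_fst fun r hr => (h₁.eval_restrict_eq_zero hg₁ hr).1
      have d2 := hz h₁.hom_snd fun r hr => (h₁.eval_restrict_eq_zero hg₁ hr).2
      exact hndvd (dvd_sub (d1.mul_right _) (d2.mul_left _))
  · have hd := hd₁.resolve_left hg₁0
    obtain ⟨e, rfl⟩ : ∃ e, g₁ = Polynomial.C e :=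
      ⟨_, Polynomial.eq_C_of_natDegree_eq_zero (by omega)⟩
    exact exists_of_cofactor_eq_C hvT hv h₁ h₂ hc hdet (by simpa using hg₁0) hg₁ hg₂ hd₂

end AdditionTheorem

/-! ### Counting crossings in the tic-tac-toe arrangement -/

section TicTacToe

open MvPolynomial LineArrangement

/-- Twice the coordinates of the intersections of a diagonal of intercept `c` with the vertical and
horizontal lines and with the anti-diagonals of intercepts `E`. -/
noncomputable def doubledCrossings (k : ℕ) (c : ℤ) (E : Finset ℤ) : Finset ℤ :=
  (Finset.Icc (-(k : ℤ)) k).image (fun i => 2 * (i + c)) ∪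
    (Finset.Icc (-(k : ℤ)) k).image (fun i => 2 * i) ∪ E.image (fun e => c - e)

lemma mem_doubledCrossings {k : ℕ} {c m : ℤ} {E : Finset ℤ} :
    m ∈ doubledCrossings k c E ↔ ((∃ i, (-(k : ℤ) ≤ i ∧ i ≤ k) ∧ 2 * (i + c) = m) ∨
      ∃ i, (-(k : ℤ) ≤ i ∧ i ≤ k) ∧ 2 * i = m) ∨ ∃ e ∈ E, c - e = m := by
  simp only [doubledCrossings, Finset.mem_union, Finset.mem_image, Finset.mem_Icc]

/-- Vertical and horizontal lines cut the diagonal at the integers in `[-k, k + j]`, the two ranges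
leaving no gap because `j ≤ k`. The anti-diagonals add the `j` half-integers between `0` and `j`.
The extreme intercepts `±j` give integer points already counted, so it is immaterial whether `E`
contains them; this keeps the count constant while lines are being added. -/
lemma card_doubledCrossings_of_eq {k j : ℕ} (hjk : j ≤ k) {E : Finset ℤ}
    (hE : ∀ e : ℤ, -j < e → e < j → e ∈ E) (hE' : ∀ e ∈ E, -(j : ℤ) ≤ e ∧ e ≤ j) :
    (doubledCrossings k j E).card = 2 * k + 1 + 2 * j := by
  have h : doubledCrossings k j E = (Finset.Icc (-(k : ℤ)) (k + j)).image (fun i => 2 * i) ∪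
      (Finset.Ico (0 : ℤ) j).image (fun i => 2 * i + 1) := by
    ext m
    simp only [mem_doubledCrossings, Finset.mem_union, Finset.mem_image, Finset.mem_Icc,
      Finset.mem_Ico]
    constructor
    · rintro ((⟨i, hi, rfl⟩ | ⟨i, hi, rfl⟩) | ⟨e, he, rfl⟩)
      · exact Or.inl ⟨i + j, by omega, rfl⟩
      · exact Or.inl ⟨i, by omega, rfl⟩
      · have := hE' e he
        rcases Int.emod_two_eq_zero_or_one ((j : ℤ) - e) with h | h
        · exact Or.inl ⟨(j - e) / 2, by omega, by omega⟩
        · exact Or.inr ⟨(j - e) / 2, by omega, by omega⟩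
    · rintro (⟨i, hi, rfl⟩ | ⟨i, hi, rfl⟩)
      · by_cases hik : i ≤ k
        · exact Or.inl (Or.inr ⟨i, by omega, rfl⟩)
        · exact Or.inl (Or.inl ⟨i - j, by omega, by omega⟩)
      · exact Or.inr ⟨j - (2 * i + 1), hE _ (by omega) (by omega), by omega⟩
  rw [h, Finset.card_union_of_disjoint, Finset.card_image_of_injective,
    Finset.card_image_of_injective, Int.card_Icc, Int.card_Ico]
  · omega
  · intro x y hxy; dsimp only at hxy; omega
  · intro x y hxy; dsimp only at hxy; omega
  · rw [Finset.disjoint_left]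
    intro m hm hm'
    obtain ⟨x, -, rfl⟩ := Finset.mem_image.1 hm
    obtain ⟨y, -, hy⟩ := Finset.mem_image.1 hm'
    omega

lemma card_doubledCrossings {k j : ℕ} (hjk : j ≤ k) {c : ℤ} (hc : c = j ∨ c = -j) {E : Finset ℤ}
    (hE : ∀ e : ℤ, -j < e → e < j → e ∈ E) (hE' : ∀ e ∈ E, -(j : ℤ) ≤ e ∧ e ≤ j) :
    (doubledCrossings k c E).card = 2 * k + 1 + 2 * j := by
  rcases hc with rfl | rfl
  · exact card_doubledCrossings_of_eq hjk hE hE'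
  -- The reflection `m ↦ -m` exchanges the intercepts `j` and `-j`.
  · rw [← card_doubledCrossings_of_eq (E := E.image Neg.neg) hjk
      (fun e h1 h2 => Finset.mem_image.2 ⟨-e, hE _ (by omega) (by omega), neg_neg e⟩)
      (fun e he => by
        obtain ⟨e', he', rfl⟩ := Finset.mem_image.1 he
        have := hE' e' he'
        omega), ← Finset.card_image_of_injective _ neg_injective]
    congr 1
    ext m
    simp only [Finset.mem_image, mem_doubledCrossings]
    constructor
    · rintro ⟨m, ((⟨i, hi, rfl⟩ | ⟨i, hi, rfl⟩) | ⟨e, he, rfl⟩), rfl⟩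
      · exact Or.inl (Or.inl ⟨-i, by omega, by ring⟩)
      · exact Or.inl (Or.inr ⟨-i, by omega, by ring⟩)
      · exact Or.inr ⟨-e, ⟨e, he, rfl⟩, by ring⟩
    · rintro ((⟨i, hi, rfl⟩ | ⟨i, hi, rfl⟩) | ⟨_, ⟨e, he, rfl⟩, rfl⟩)
      · exact ⟨_, Or.inl (Or.inl ⟨-i, by omega, rfl⟩), by ring⟩
      · exact ⟨_, Or.inl (Or.inr ⟨-i, by omega, rfl⟩), by ring⟩
      · exact ⟨_, Or.inr ⟨e, he, rfl⟩, by ring⟩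

open Classical in
/-- The vertical and horizontal lines of the tic-tac-toe arrangement, with the diagonals of
intercepts `D` and the anti-diagonals of intercepts `E`. -/
noncomputable def gridLines (k : ℕ) (D E : Finset ℤ) : Finset (Fin 3 → ℂ) :=
  (Finset.Icc (-(k : ℤ)) k).image verticalLine ∪ (Finset.Icc (-(k : ℤ)) k).image horizontalLine ∪
    D.image diagonalLine ∪ E.image antidiagonalLine

variable {k j a : ℕ} {D E : Finset ℤ} {c : ℤ}

lemma mem_gridLines {v : Fin 3 → ℂ} : v ∈ gridLines k D E ↔
    (((∃ i, (-(k : ℤ) ≤ i ∧ i ≤ k) ∧ verticalLine i = v) ∨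
      ∃ i, (-(k : ℤ) ≤ i ∧ i ≤ k) ∧ horizontalLine i = v) ∨
      ∃ d ∈ D, diagonalLine d = v) ∨ ∃ e ∈ E, antidiagonalLine e = v := by
  simp only [gridLines, Finset.mem_union, Finset.mem_image, Finset.mem_Icc]

lemma isNormalized_of_mem_gridLines {v : Fin 3 → ℂ} (hv : v ∈ gridLines k D E) :
    IsNormalized v := by
  rcases mem_gridLines.1 hv with ((⟨i, -, rfl⟩ | ⟨i, -, rfl⟩) | ⟨i, -, rfl⟩) | ⟨i, -, rfl⟩ <;>
    simp [IsNormalized, verticalLine, horizontalLine, diagonalLine, antidiagonalLine]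

lemma lineAtInfinity_notMem_gridLines : lineAtInfinity ∉ gridLines k D E := by
  intro hv
  rcases mem_gridLines.1 hv with ((⟨i, -, h⟩ | ⟨i, -, h⟩) | ⟨i, -, h⟩) | ⟨i, -, h⟩ <;>
    have h0 := congr_fun h 0 <;> have h1 := congr_fun h 1 <;>
    simp [lineAtInfinity, verticalLine, horizontalLine, diagonalLine, antidiagonalLine] at h0 h1

lemma diagonalLine_notMem_gridLines (hc : c ∉ D) : diagonalLine c ∉ gridLines k D E := by
  intro hv
  rcases mem_gridLines.1 hv with ((⟨i, -, h⟩ | ⟨i, -, h⟩) | ⟨i, hi, h⟩) | ⟨i, -, h⟩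
  · simpa [diagonalLine, verticalLine] using congr_fun h 1
  · simpa [diagonalLine, horizontalLine] using congr_fun h 0
  · have : i = c := by simpa [diagonalLine] using congr_fun h 2
    exact hc (this ▸ hi)
  · have := congr_fun h 1
    norm_num [diagonalLine, antidiagonalLine] at this

lemma antidiagonalLine_notMem_gridLines (hc : c ∉ E) : antidiagonalLine c ∉ gridLines k D E := by
  intro hv
  rcases mem_gridLines.1 hv with ((⟨i, -, h⟩ | ⟨i, -, h⟩) | ⟨i, -, h⟩) | ⟨i, hi, h⟩
  · simpa [antidiagonalLine, verticalLine] using congr_fun h 1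
  · simpa [antidiagonalLine, horizontalLine] using congr_fun h 0
  · have := congr_fun h 1
    norm_num [diagonalLine, antidiagonalLine] at this
  · have : i = c := by simpa [antidiagonalLine] using congr_fun h 2
    exact hc (this ▸ hi)

open Classical in
lemma gridLines_insert_diagonal :
    gridLines k (insert c D) E = insert (diagonalLine c) (gridLines k D E) := by
  ext v
  simp only [gridLines, Finset.image_insert, Finset.mem_union, Finset.mem_insert]
  tauto

open Classical in
lemma gridLines_insert_antidiagonal :
    gridLines k D (insert c E) = insert (antidiagonalLine c) (gridLines k D E) := by
  ext v
  simp only [gridLines, Finset.image_insert, Finset.mem_union, Finset.mem_insert]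
  tauto

lemma mem_crossings {v : Fin 3 → ℂ} {T : Finset (Fin 3 → ℂ)} {r : ℂ} :
    r ∈ crossings v T ↔ ∃ w ∈ T, w 1 - w 0 * v 1 ≠ 0 ∧ crossing v w = r := by
  simp only [crossings, Finset.mem_image, mem_transversals, and_assoc]

lemma crossings_diagonalLine :
    crossings (diagonalLine c) (gridLines k D E) =
      (doubledCrossings k c E).image (fun m : ℤ => (m : ℂ) / 2) := by
  ext r
  simp only [mem_crossings, mem_gridLines, Finset.mem_image, mem_doubledCrossings]
  constructor
  · rintro ⟨w, ((⟨i, hi, rfl⟩ | ⟨i, hi, rfl⟩) | ⟨i, hi, rfl⟩) | ⟨i, hi, rfl⟩, hw, rfl⟩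
    · refine ⟨_, Or.inl (Or.inl ⟨i, hi, rfl⟩), ?_⟩
      simp [crossing, diagonalLine, verticalLine]
      ring
    · refine ⟨_, Or.inl (Or.inr ⟨i, hi, rfl⟩), ?_⟩
      simp [crossing, diagonalLine, horizontalLine]
    · simp [diagonalLine] at hw
    · refine ⟨_, Or.inr ⟨i, hi, rfl⟩, ?_⟩
      simp [crossing, diagonalLine, antidiagonalLine]
      ring
  · rintro ⟨m, ((⟨i, hi, rfl⟩ | ⟨i, hi, rfl⟩) | ⟨i, hi, rfl⟩), rfl⟩
    · refine ⟨_, Or.inl (Or.inl (Or.inl ⟨i, hi, rfl⟩)), ?_⟩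
      simp [crossing, diagonalLine, verticalLine]
      ring
    · refine ⟨_, Or.inl (Or.inl (Or.inr ⟨i, hi, rfl⟩)), ?_⟩
      simp [crossing, diagonalLine, horizontalLine]
    · refine ⟨_, Or.inr ⟨i, hi, rfl⟩, ?_⟩
      simp only [crossing, diagonalLine, antidiagonalLine, Matrix.cons_val]
      norm_num

/-- The reflection `y ↦ -y` preserves the grid and exchanges diagonals with anti-diagonals, hence
the same count up to sign. -/
lemma crossings_antidiagonalLine :
    crossings (antidiagonalLine c) (gridLines k D E) =
      (doubledCrossings k c D).image (fun m : ℤ => -(m : ℂ) / 2) := by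
  ext r
  simp only [mem_crossings, mem_gridLines, Finset.mem_image, mem_doubledCrossings]
  constructor
  · rintro ⟨w, ((⟨i, hi, rfl⟩ | ⟨i, hi, rfl⟩) | ⟨i, hi, rfl⟩) | ⟨i, hi, rfl⟩, hw, rfl⟩
    · refine ⟨_, Or.inl (Or.inl ⟨i, hi, rfl⟩), ?_⟩
      simp [crossing, antidiagonalLine, verticalLine]
      ring
    · refine ⟨_, Or.inl (Or.inr ⟨-i, by omega, rfl⟩), ?_⟩
      simp [crossing, antidiagonalLine, horizontalLine]
    · refine ⟨_, Or.inr ⟨i, hi, rfl⟩, ?_⟩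
      simp only [crossing, diagonalLine, antidiagonalLine, Matrix.cons_val]
      norm_num
      ring
    · simp [antidiagonalLine] at hw
  · rintro ⟨m, ((⟨i, hi, rfl⟩ | ⟨i, hi, rfl⟩) | ⟨i, hi, rfl⟩), rfl⟩
    · refine ⟨_, Or.inl (Or.inl (Or.inl ⟨i, hi, rfl⟩)), ?_⟩
      simp [crossing, antidiagonalLine, verticalLine]
      ring
    · refine ⟨_, Or.inl (Or.inl (Or.inr ⟨-i, by omega, rfl⟩)), ?_⟩
      simp [crossing, antidiagonalLine, horizontalLine]
      ring
    · refine ⟨_, Or.inl (Or.inr ⟨i, hi, rfl⟩), ?_⟩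
      simp only [crossing, diagonalLine, antidiagonalLine, Matrix.cons_val]
      norm_num
      ring

lemma HasSaitoBasis.insert_diagonal (hjk : j ≤ k) (hc : c = j ∨ c = -j) (hcD : c ∉ D)
    (hE : ∀ e : ℤ, -j < e → e < j → e ∈ E) (hE' : ∀ e ∈ E, -(j : ℤ) ≤ e ∧ e ≤ j)
    (h : HasSaitoBasis (gridLines k D E) a (2 * k + 1 + 2 * j)) :
    HasSaitoBasis (gridLines k (insert c D) E) (a + 1) (2 * k + 1 + 2 * j) := by
  classical
  rw [gridLines_insert_diagonal]
  refine h.addition (fun _ => isNormalized_of_mem_gridLines) lineAtInfinity_notMem_gridLines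
    (by simp [diagonalLine]) (diagonalLine_notMem_gridLines hcD) ?_
  rw [crossings_diagonalLine, Finset.card_image_of_injective, card_doubledCrossings hjk hc hE hE']
  intro x y hxy
  simpa using hxy

lemma HasSaitoBasis.insert_antidiagonal (hjk : j ≤ k) (hc : c = j ∨ c = -j) (hcE : c ∉ E)
    (hD : ∀ e : ℤ, -j < e → e < j → e ∈ D) (hD' : ∀ e ∈ D, -(j : ℤ) ≤ e ∧ e ≤ j)
    (h : HasSaitoBasis (gridLines k D E) a (2 * k + 1 + 2 * j)) :
    HasSaitoBasis (gridLines k D (insert c E)) (a + 1) (2 * k + 1 + 2 * j) := by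
  classical
  rw [gridLines_insert_antidiagonal]
  refine h.addition (fun _ => isNormalized_of_mem_gridLines) lineAtInfinity_notMem_gridLines
    (by simp [antidiagonalLine]) (antidiagonalLine_notMem_gridLines hcE) ?_
  rw [crossings_antidiagonalLine, Finset.card_image_of_injective,
    card_doubledCrossings hjk hc hD hD']
  intro x y hxy
  simpa using hxy

/-- The grid of vertical and horizontal lines has both exponents equal to `2k + 1`. -/
lemma hasSaitoBasis_grid (k : ℕ) : HasSaitoBasis (gridLines k ∅ ∅) (2 * k + 1) (2 * k + 1) := by
  classical
  have hhom : ∀ l : ℤ → Fin 3 → ℂ,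
      (∏ i ∈ Finset.Icc (-(k : ℤ)) k, linearForm (l i)).IsHomogeneous (2 * k + 1) := fun l => by
    have := IsHomogeneous.prod (Finset.Icc (-(k : ℤ)) k) (fun i => linearForm (l i)) (fun _ => 1)
      fun i _ => linearForm_isHomogeneous (l i)
    rw [Finset.sum_const, Int.card_Icc, smul_eq_mul, mul_one] at this
    convert this using 1
    omega
  have hmem : ∀ v ∈ gridLines k ∅ ∅, (∃ i, i ∈ Finset.Icc (-(k : ℤ)) k ∧ verticalLine i = v) ∨
      ∃ i, i ∈ Finset.Icc (-(k : ℤ)) k ∧ horizontalLine i = v := fun v hv => by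
    simpa [mem_gridLines] using hv
  refine ⟨∏ i ∈ Finset.Icc (-(k : ℤ)) k, linearForm (verticalLine i), 0, 0,
    ∏ i ∈ Finset.Icc (-(k : ℤ)) k, linearForm (horizontalLine i), 1,
    ⟨hhom _, isHomogeneous_zero _ _ _, fun v hv => ?_⟩,
    ⟨isHomogeneous_zero _ _ _, hhom _, fun v hv => ?_⟩, one_ne_zero, ?_⟩
  · rcases hmem v hv with ⟨i, hi, rfl⟩ | ⟨i, hi, rfl⟩
    · rw [mul_zero, add_zero]
      exact (Finset.dvd_prod_of_mem (fun i => linearForm (verticalLine i)) hi).mul_left _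
    · simp [horizontalLine]
  · rcases hmem v hv with ⟨i, hi, rfl⟩ | ⟨i, hi, rfl⟩
    · simp [verticalLine]
    · rw [mul_zero, zero_add]
      exact (Finset.dvd_prod_of_mem (fun i => linearForm (horizontalLine i)) hi).mul_left _
  · rw [gridLines, Finset.image_empty, Finset.image_empty, Finset.union_empty, Finset.union_empty,
      Finset.prod_union, Finset.prod_image, Finset.prod_image, C_1, one_mul, zero_mul, sub_zero]
    · intro x _ y _ hxy
      simpa [horizontalLine] using congr_fun hxy 2
    · intro x _ y _ hxy
      simpa [verticalLine] using congr_fun hxy 2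
    · rw [Finset.disjoint_left]
      intro v hv hv'
      obtain ⟨x, -, rfl⟩ := Finset.mem_image.1 hv
      obtain ⟨y, -, hy⟩ := Finset.mem_image.1 hv'
      simpa [horizontalLine, verticalLine] using congr_fun hy 0

lemma Icc_succ_eq_insert (j : ℕ) : Finset.Icc (-((j + 1 : ℕ) : ℤ)) ((j + 1 : ℕ) : ℤ) =
    insert (-((j + 1 : ℕ) : ℤ)) (insert ((j + 1 : ℕ) : ℤ) (Finset.Icc (-(j : ℤ)) j)) := by
  ext e
  simp only [Finset.mem_Icc, Finset.mem_insert]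
  omega

/-- The tic-tac-toe lines have a Saito basis of degrees `2k + 1 + 2j` and `2k + 3 + 2j`. -/
theorem hasSaitoBasis_gridLines (k j : ℕ) (hjk : j ≤ k) :
    HasSaitoBasis (gridLines k (Finset.Icc (-(j : ℤ)) j) (Finset.Icc (-(j : ℤ)) j))
      (2 * k + 1 + 2 * j) (2 * k + 3 + 2 * j) := by
  induction j with
  | zero =>
    -- The diagonal and the anti-diagonal of intercept `0` cross the grid only at its `2k + 1`
    -- integer points on them, and they meet each other at one of these.
    have h1 := (hasSaitoBasis_grid k).insert_diagonal (j := 0) (c := 0) (Nat.zero_le k)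
      (by simp) (by simp) (by intro e; omega) (by simp)
    have h2 := h1.insert_antidiagonal (j := 0) (c := 0) (Nat.zero_le k)
      (by simp) (by simp) (by intro e; omega) (by simp)
    exact h2.symm
  | succ j ih =>
    have h0 := ih (by omega)
    -- The larger exponent at stage `j` equals the number of crossings of each line added at stage
    -- `j + 1`.
    rw [show 2 * k + 3 + 2 * j = 2 * k + 1 + 2 * (j + 1) by ring] at h0
    have hI : ∀ e : ℤ, -((j + 1 : ℕ) : ℤ) < e → e < (j + 1 : ℕ) → e ∈ Finset.Icc (-(j : ℤ)) j :=
      fun e _ _ => Finset.mem_Icc.2 (by omega)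
    have hI' : ∀ e ∈ Finset.Icc (-(j : ℤ)) j, -((j + 1 : ℕ) : ℤ) ≤ e ∧ e ≤ (j + 1 : ℕ) :=
      fun e he => by rw [Finset.mem_Icc] at he; omega
    have hn : ((j + 1 : ℕ) : ℤ) ∉ Finset.Icc (-(j : ℤ)) j := by rw [Finset.mem_Icc]; omega
    have hn' : -((j + 1 : ℕ) : ℤ) ∉ insert ((j + 1 : ℕ) : ℤ) (Finset.Icc (-(j : ℤ)) j) := by
      rw [Finset.mem_insert, Finset.mem_Icc]; omega
    have h1 := h0.insert_diagonal hjk (Or.inl rfl) hn hI hI'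
    have h2 := h1.insert_diagonal hjk (Or.inr rfl) hn' hI hI'
    rw [← Icc_succ_eq_insert] at h2
    have hJ : ∀ e : ℤ, -((j + 1 : ℕ) : ℤ) < e → e < (j + 1 : ℕ) →
        e ∈ Finset.Icc (-((j + 1 : ℕ) : ℤ)) (j + 1 : ℕ) :=
      fun e _ _ => Finset.mem_Icc.2 (by omega)
    have h3 := h2.insert_antidiagonal hjk (Or.inl rfl) hn hJ fun e he => Finset.mem_Icc.1 he
    have h4 := h3.insert_antidiagonal hjk (Or.inr rfl) hn' hJ fun e he => Finset.mem_Icc.1 he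
    rw [← Icc_succ_eq_insert] at h4
    convert h4.symm using 1
    ring

end TicTacToe

/-! ### Freeness of the complete arrangement -/

theorem mainTheorem5 (k j : ℕ) (hj : 0 < j) (hjk : j ≤ k) :
    (completeTicTacToe k j).IsFreeWithSplittingType (2 * k + 1 + 2 * j) (2 * k + 3 + 2 * j) := by
  classical
  obtain ⟨θ₁, θ₂, h⟩ := (hasSaitoBasis_gridLines k j hjk).exists_isSyzygyBasis
    (fun _ => isNormalized_of_mem_gridLines) lineAtInfinity_notMem_gridLines
  have hforms : (completeTicTacToe k j).definingPolynomial =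
      ∏ v ∈ insert lineAtInfinity
        (gridLines k (Finset.Icc (-(j : ℤ)) j) (Finset.Icc (-(j : ℤ)) j)),
        LineArrangement.linearForm v := by
    rw [LineArrangement.definingPolynomial]
    refine Finset.prod_congr ?_ fun _ _ => rfl
    ext v
    exact Iff.of_eq (by congr!)
  rw [← hforms] at h
  exact h.nonempty_kernel_iso fun i =>
    (completeTicTacToe k j).definingPolynomial_isHomogeneous.pderiv
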